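/- **Setting.** Let $q\in\{1,2\}$ and let $\mathbb R^4_q$ be $\mathbb R^4$ with the scalar product $\langle\cdot,\cdot\rangle$ having $q$ negative signs. Fix a constant $a>0$, an interval $I$ with nonempty interior, and signs $\varepsilon_1,\varepsilon_2\in\{\pm1\}$ with $\varepsilon_1=\varepsilon_2=1$ if $q=1$ and $\varepsilon_1\varepsilon_2=-1$ if $q=2$. Let $\Lambda$ be the space of smooth null curves $\gamma:I\to\mathbb R^4_q$, parametrized by pseudo arc-length $\sigma$, with positively oriented Cartan frame $T=\gamma',W_1,N,W_2$: $\langle T,T\rangle=\langle N,N\rangle=0$, $\langle T,N\rangle=-1$, $\langle W_i,T\rangle=\langle W_i,N\rangle=0$, $\langle W_i,W_j\rangle=\varepsilon_i\delta_{ij}$, and $$T'=aW_1,\quad W_1'=-k_1T+a\varepsilon_1N,\quad N'=-\varepsilon_1k_1W_1+\varepsilon_2k_2W_2,\quad W_2'=k_2T .$$ Let $\mathcal P=\mathbb R[k_1^{(m)},k_2^{(n)}:m,n\in\mathbb N]$ be the algebra of differential polynomials, with total derivative $'=D_\sigma$, and for $p,r\in\mathcal P$ let $\partial_{(p,r)}=\sum_m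 p^{(m)}\partial/\partial k_1^{(m)}+\sum_m r^{(m)}\partial/\partial k_2^{(m)}$. A $\mathcal P$-local vector field is $V=fT+hW_1+gN+lW_2$ with $f,h,g,l\in\mathcal P$; the Cartan equations define $\nabla_TV$. Put $$\varphi_V=\varepsilon_1\langle\nabla_TV,W_1\rangle,\quad \psi_V=\varepsilon_2\langle\nabla_TV,W_2\rangle,\quad \rho_V=-\varepsilon_1\langle\nabla_T^2V,W_1\rangle,$$ $$\alpha_V=\tfrac1a(\varphi_V'+\tfrac12\rho_V),\quad \beta_V=\tfrac1a(\alpha_V'+k_1\varphi_V-k_2\psi_V),\quad \delta_V=\tfrac1a\psi_V''+k_1\psi_V+\varepsilon_1\varepsilon_2k_2\varphi_V .$$ With $\theta=\frac1aD_\sigma^3+k_1D_\sigma+D_\sigma k_1$ and $S=D_\sigma k_2+k_2D_\sigma$, a vector field $V$ acts on $\mathcal P$ as the derivation with $$V(k_1)=\tfrac1a\big(\theta\varphi_V-S\psi_V+\tfrac1{2a}\rho_V''+k_1\rho_V\big),\quad V(k_2)=\tfrac1a\big(S\varphi_V+\varepsilon_1\varepsilon_2\theta\psi_V+k_2\rho_V\big),\quad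 V(f')=V(f)'+\tfrac1{2a}\rho_Vf',$$ and $D_V$ is the tensor derivation on $\mathcal P$-local vector fields extending it (that is, $D_V(fX)=V(f)X+fD_VX$) with $$\begin{aligned}D_VT&=-\alpha_VT+\varphi_VW_1+\psi_VW_2,& D_VW_1&=-\beta_VT+\varepsilon_1\varphi_VN+\tfrac1a\psi_V'W_2,\\ D_VN&=-\varepsilon_1\beta_VW_1+\alpha_VN+\tfrac{\varepsilon_1}a\delta_VW_2,& D_VW_2&=\tfrac{\varepsilon_1\varepsilon_2}a\delta_VT-\tfrac{\varepsilon_1\varepsilon_2}a\psi_V'W_1+\varepsilon_2\psi_VN.\end{aligned}$$ Let $\mathcal A$ be the algebra of $\mathcal P$-valued scalar fields on $\Lambda$ (maps $\gamma\mapsto f_\gamma\in\mathcal P$). An $\mathcal A$-local vector field assigns to each $\gamma\in\Lambda$ a $\mathcal P$-local vector field $V_\gamma$. The space $\mathfrak X_{\mathcal A}(\Lambda)$ of evolution vector fields consists of those whose components satisfy, for every $\gamma$, $$h=-\tfrac{\varepsilon_1}ag',\qquad f=\tfrac1{2a}\big[\tfrac{\varepsilon_1}ag''+D_\sigma^{-1}(\varepsilon_1k_1'g-ak_2l)\big],$$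 where $D_\sigma^{-1}$ denotes any antiderivative in $\mathcal P$. All operations are taken at each $\gamma$ separately; in particular $[V,U]_\gamma=D_{V_\gamma}U_\gamma-D_{U_\gamma}V_\gamma$ and $(\partial_{(p,r)}f)_\gamma=\partial_{(p_\gamma,r_\gamma)}f_\gamma$. Let $\mathrm{der}^*(\mathcal A)$ be the Lie algebra of all evolution derivations $\partial_{(p,r)}$, $p,r\in\mathcal A$, under the commutator. **Theorem 1.** 1. The model is faithful: a differential polynomial that vanishes along every $\gamma\in\Lambda$ is $0$. Moreover, for $V\in\mathfrak X_{\mathcal A}(\Lambda)$ and $\gamma\in\Lambda$, the actual vector field $V$ along $\gamma$ satisfies $\langle\nabla_TV,T\rangle=\langle\nabla_T^2V,W_1\rangle=0$, and $\varepsilon_1\langle\nabla_TV,W_1\rangle$, $\varepsilon_2\langle\nabla_TV,W_2\rangle$ are the values along $\gamma$ of $\varphi_V$, $\psi_V$. 2. $\mathfrak X_{\mathcal A}(\Lambda)$ is closed under $[\cdot,\cdot]$ and is a Lie algebra over $\mathbb R$ with this bracket. 3. The map $\Phi:\mathfrak X_{\mathcal A}(\Lambda)\to\mathrm{der}^*(\mathcal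 A)$, $$\Phi(V)=\partial_{(V(k_1),V(k_2))}=\partial_{\Theta(\varphi_V,-\psi_V)},\qquad \Theta=\frac1a\begin{pmatrix}\theta&S\\ S&-\varepsilon_1\varepsilon_2\theta\end{pmatrix}$$ ($\Theta$ is the Hirota–Satsuma cosymplectic operator, up to scaling), is an injective homomorphism of Lie algebras. 4. Two evolution vector fields $V_1,V_2$ satisfy $[V_1,V_2]=0$ if and only if their curvature flows $A_i=(V_i(k_1),V_i(k_2))$ commute, that is, $\partial_{A_1}A_2-\partial_{A_2}A_1=0$. -/

import Mathlib

open scoped ContDiff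

namespace NullCurve

noncomputable section

/-! ### Null curves in pseudo-Euclidean four-space -/

/-- The scalar product of index `q` on `ℝ⁴`: the first `q` coordinates are negative. -/
def metric (q : ℕ) (x y : Fin 4 → ℝ) : ℝ :=
  ∑ i : Fin 4, (if (i : ℕ) < q then -1 else 1) * (x i * y i)

/-- A map on the interval `I`, extended by zero to the real line (only its values on `I` are
ever used). -/
def ext {I : Set ℝ} {F : Type} [Zero F] (X : I → F) : ℝ → F :=
  Function.extend Subtype.val X 0

/-- Smoothness (`C^∞`) of a map on the interval `I`. -/
def Smooth {I : Set ℝ} {F : Type} [NormedAddCommGroup F] [NormedSpace ℝ F] (X : I → F) : Prop :=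
  ContDiffOn ℝ ∞ (ext X) I

/-- The derivative (one-sided at end points) of a map on the interval `I`. For a vector field along
a curve in the flat space `ℝ⁴_q` this is the covariant derivative `∇_T`. -/
def dσ {I : Set ℝ} {F : Type} [NormedAddCommGroup F] [NormedSpace ℝ F] (X : I → F) : I → F :=
  fun s => derivWithin (ext X) I s

/-- The space `Λ` of null curves `I → ℝ⁴_q` parametrized by the pseudo arc-length parameter
(normalized by the constant `a`), with causal characters `ε₁, ε₂` of the screen bundle, each with
its Cartan frame and its curvatures. The frame is the positively oriented one, so that it and the
curvatures are determined by the curve. -/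
structure Curve (I : Set ℝ) (q : ℕ) (a ε₁ ε₂ : ℝ) where
  /-- the curve -/
  curve : I → Fin 4 → ℝ
  /-- the tangent vector -/
  T : I → Fin 4 → ℝ
  W₁ : I → Fin 4 → ℝ
  N : I → Fin 4 → ℝ
  W₂ : I → Fin 4 → ℝ
  /-- first curvature -/
  k₁ : I → ℝ
  /-- second curvature -/
  k₂ : I → ℝ
  smooth_curve : Smooth curve
  smooth_W₁ : Smooth W₁
  smooth_N : Smooth N
  smooth_W₂ : Smooth W₂
  smooth_k₁ : Smooth k₁
  smooth_k₂ : Smooth k₂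
  T_eq : T = dσ curve
  T_T : ∀ s, metric q (T s) (T s) = 0
  N_N : ∀ s, metric q (N s) (N s) = 0
  T_N : ∀ s, metric q (T s) (N s) = -1
  W₁_T : ∀ s, metric q (W₁ s) (T s) = 0
  W₁_N : ∀ s, metric q (W₁ s) (N s) = 0
  W₂_T : ∀ s, metric q (W₂ s) (T s) = 0
  W₂_N : ∀ s, metric q (W₂ s) (N s) = 0
  W₁_W₁ : ∀ s, metric q (W₁ s) (W₁ s) = ε₁
  W₂_W₂ : ∀ s, metric q (W₂ s) (W₂ s) = ε₂
  W₁_W₂ : ∀ s, metric q (W₁ s) (W₂ s) = 0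
  oriented : ∀ s, 0 < (Matrix.of ![T s, W₁ s, N s, W₂ s]).det
  cartan_T : ∀ s, dσ T s = a • W₁ s
  cartan_W₁ : ∀ s, dσ W₁ s = -(k₁ s) • T s + (a * ε₁) • N s
  cartan_N : ∀ s, dσ N s = -(ε₁ * k₁ s) • W₁ s + (ε₂ * k₂ s) • W₂ s
  cartan_W₂ : ∀ s, dσ W₂ s = k₂ s • T s

/-! ### Differential polynomials in the curvatures -/

/-- The algebra `𝒫 = ℝ[k₁^(m), k₂^(n) : m, n ∈ ℕ]`; the variable `(0, m)` is `k₁^(m)` and the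
variable `(1, n)` is `k₂^(n)`. -/
abbrev DiffPoly : Type := MvPolynomial (Fin 2 × ℕ) ℝ

def κ₁ : DiffPoly := MvPolynomial.X (0, 0)

def κ₂ : DiffPoly := MvPolynomial.X (1, 0)

/-- The total derivative `D_σ` on `𝒫`. -/
def D : Derivation ℝ DiffPoly DiffPoly :=
  MvPolynomial.mkDerivation ℝ fun v => MvPolynomial.X (v.1, v.2 + 1)

/-- The evolution derivation `∂_{(p,r)} = ∑ₘ p^(m) ∂/∂k₁^(m) + ∑ₘ r^(m) ∂/∂k₂^(m)` of `𝒫`. -/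
def evolPoly (p r : DiffPoly) : Derivation ℝ DiffPoly DiffPoly :=
  MvPolynomial.mkDerivation ℝ fun v => (⇑D)^[v.2] (![p, r] v.1)

/-- The function on `I` represented by a differential polynomial along a curve `γ ∈ Λ`. -/
def evalAt {I : Set ℝ} {q : ℕ} {a ε₁ ε₂ : ℝ} (γ : Curve I q a ε₁ ε₂) : DiffPoly →ₐ[ℝ] (I → ℝ) :=
  MvPolynomial.aeval fun v => dσ^[v.2] (![γ.k₁, γ.k₂] v.1)

/-! ### `𝒫`-local vector fields along a curve -/

/-- A `𝒫`-local vector field `f T + h W₁ + g N + l W₂`, given by its components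
`![f, h, g, l]` in the Cartan frame. -/
abbrev LocalField : Type := Fin 4 → DiffPoly

/-- The vector field along `γ` given by a `𝒫`-local vector field. -/
def realize {I : Set ℝ} {q : ℕ} {a ε₁ ε₂ : ℝ} (γ : Curve I q a ε₁ ε₂) (V : LocalField) :
    I → Fin 4 → ℝ :=
  fun s => evalAt γ (V 0) s • γ.T s + evalAt γ (V 1) s • γ.W₁ s +
    evalAt γ (V 2) s • γ.N s + evalAt γ (V 3) s • γ.W₂ s

/-- The frame fields `T, W₁, N, W₂` as `𝒫`-local vector fields. -/
def frame (i : Fin 4) : LocalField := Pi.single i 1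

/-- The scalar product of `𝒫`-local vector fields. -/
def pair (ε₁ ε₂ : ℝ) (V U : LocalField) : DiffPoly :=
  -(V 0 * U 2 + V 2 * U 0) + ε₁ • (V 1 * U 1) + ε₂ • (V 3 * U 3)

/-- The covariant derivative `∇_T` on `𝒫`-local vector fields, computed by the Cartan equations. -/
def nabla (a ε₁ ε₂ : ℝ) (V : LocalField) : LocalField :=
  ![D (V 0) - κ₁ * V 1 + κ₂ * V 3,
    a • V 0 + D (V 1) - ε₁ • (κ₁ * V 2),
    (ε₁ * a) • V 1 + D (V 2),
    D (V 3) + ε₂ • (κ₂ * V 2)]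

/-- `φ_V = ε₁ ⟨∇_T V, W₁⟩`. -/
def phi (a ε₁ ε₂ : ℝ) (V : LocalField) : DiffPoly :=
  ε₁ • pair ε₁ ε₂ (nabla a ε₁ ε₂ V) (frame 1)

/-- `ψ_V = ε₂ ⟨∇_T V, W₂⟩`. -/
def psi (a ε₁ ε₂ : ℝ) (V : LocalField) : DiffPoly :=
  ε₂ • pair ε₁ ε₂ (nabla a ε₁ ε₂ V) (frame 3)

/-- `ρ_V = -ε₁ ⟨∇_T² V, W₁⟩`. -/
def rho (a ε₁ ε₂ : ℝ) (V : LocalField) : DiffPoly :=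
  -(ε₁ • pair ε₁ ε₂ (nabla a ε₁ ε₂ (nabla a ε₁ ε₂ V)) (frame 1))

def alpha (a ε₁ ε₂ : ℝ) (V : LocalField) : DiffPoly :=
  (1 / a) • (D (phi a ε₁ ε₂ V) + (1 / 2 : ℝ) • rho a ε₁ ε₂ V)

def beta (a ε₁ ε₂ : ℝ) (V : LocalField) : DiffPoly :=
  (1 / a) • (D (alpha a ε₁ ε₂ V) + κ₁ * phi a ε₁ ε₂ V - κ₂ * psi a ε₁ ε₂ V)

def delta (a ε₁ ε₂ : ℝ) (V : LocalField) : DiffPoly :=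
  (1 / a) • D (D (psi a ε₁ ε₂ V)) + κ₁ * psi a ε₁ ε₂ V + (ε₁ * ε₂) • (κ₂ * phi a ε₁ ε₂ V)

/-- The operator `θ(k₁) = (1/a) D³ + k₁ D + D k₁`. -/
def theta (a : ℝ) (p : DiffPoly) : DiffPoly :=
  (1 / a) • D (D (D p)) + κ₁ * D p + D (κ₁ * p)

/-- The operator `S(k₂) = D k₂ + k₂ D`. -/
def opS (p : DiffPoly) : DiffPoly := D (κ₂ * p) + κ₂ * D p

/-- First component of the Hirota–Satsuma cosymplectic operator
`Θ = (1/a) (θ(k₁), S(k₂); S(k₂), -ε₁ε₂ θ(k₁))`. -/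
def Theta₁ (a : ℝ) (p r : DiffPoly) : DiffPoly := (1 / a) • (theta a p + opS r)

/-- Second component of the Hirota–Satsuma cosymplectic operator. -/
def Theta₂ (a ε₁ ε₂ : ℝ) (p r : DiffPoly) : DiffPoly :=
  (1 / a) • (opS p - (ε₁ * ε₂) • theta a r)

/-- The action of a local vector field `V` (preserving the causal character) on the first
curvature, in flat space. -/
def actK₁ (a ε₁ ε₂ : ℝ) (V : LocalField) : DiffPoly :=
  (1 / a) • theta a (phi a ε₁ ε₂ V) - (1 / a) • opS (psi a ε₁ ε₂ V) +
    (1 / a) • ((1 / (2 * a)) • D (D (rho a ε₁ ε₂ V)) + κ₁ * rho a ε₁ ε₂ V)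

/-- The action of a local vector field `V` (preserving the causal character) on the second
curvature, in flat space. -/
def actK₂ (a ε₁ ε₂ : ℝ) (V : LocalField) : DiffPoly :=
  (1 / a) • opS (phi a ε₁ ε₂ V) + (ε₁ * ε₂ / a) • theta a (psi a ε₁ ε₂ V) +
    (1 / a) • (κ₂ * rho a ε₁ ε₂ V)

/-- The values `V(k₁^(m))`, `V(k₂^(m))`, forced by `V(f') = V(f)' + (1/2a) ρ_V f'`. -/
def actGen (a ε₁ ε₂ : ℝ) (V : LocalField) (i : Fin 2) : ℕ → DiffPoly
  | 0 => ![actK₁ a ε₁ ε₂ V, actK₂ a ε₁ ε₂ V] i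
  | m + 1 => D (actGen a ε₁ ε₂ V i m) +
      (1 / (2 * a)) • (rho a ε₁ ε₂ V * MvPolynomial.X (i, m + 1))

/-- A local vector field `V` as a derivation `f ↦ V(f)` of `𝒫`. -/
def act (a ε₁ ε₂ : ℝ) (V : LocalField) : Derivation ℝ DiffPoly DiffPoly :=
  MvPolynomial.mkDerivation ℝ fun v => actGen a ε₁ ε₂ V v.1 v.2

/-- The fields `D_V T, D_V W₁, D_V N, D_V W₂`. -/
def covFrame (a ε₁ ε₂ : ℝ) (V : LocalField) : Fin 4 → LocalField :=
  ![![-alpha a ε₁ ε₂ V, phi a ε₁ ε₂ V, 0, psi a ε₁ ε₂ V],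
    ![-beta a ε₁ ε₂ V, 0, ε₁ • phi a ε₁ ε₂ V, (1 / a) • D (psi a ε₁ ε₂ V)],
    ![0, -(ε₁ • beta a ε₁ ε₂ V), alpha a ε₁ ε₂ V, (ε₁ / a) • delta a ε₁ ε₂ V],
    ![(ε₁ * ε₂ / a) • delta a ε₁ ε₂ V, -((ε₁ * ε₂ / a) • D (psi a ε₁ ε₂ V)),
      ε₂ • psi a ε₁ ε₂ V, 0]]

/-- The tensor derivation `D_V` on local vector fields: `D_V (∑ uᵢ Eᵢ) = ∑ (V(uᵢ) Eᵢ + uᵢ D_V Eᵢ)`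
for the Cartan frame `E`. -/
def covD (a ε₁ ε₂ : ℝ) (V U : LocalField) : LocalField :=
  ∑ i : Fin 4, (act a ε₁ ε₂ V (U i) • frame i + U i • covFrame a ε₁ ε₂ V i)

/-- The bracket `[V, U]_γ = D_V U - D_U V`. -/
def bracket (a ε₁ ε₂ : ℝ) (V U : LocalField) : LocalField :=
  covD a ε₁ ε₂ V U - covD a ε₁ ε₂ U V

/-- The local vector fields that preserve the causal character and the pseudo arc-length parameter:
`h = -(ε₁/a) g'` and `f = (1/2a) [(ε₁/a) g'' + D⁻¹(ε₁ k₁' g - a k₂ l)]`, where `D⁻¹` is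
any antiderivative in `𝒫`. -/
def IsEvolution (a ε₁ : ℝ) (V : LocalField) : Prop :=
  V 1 = -((ε₁ / a) • D (V 2)) ∧
    ∃ r : DiffPoly, D r = ε₁ • (D κ₁ * V 2) - a • (κ₂ * V 3) ∧
      V 0 = (1 / (2 * a)) • ((ε₁ / a) • D (D (V 2)) + r)

/-! ### Scalar fields and vector fields on `Λ` -/

/-- The algebra `𝒜` of `𝒫`-valued scalar fields on `Λ`. -/
abbrev ScalarField (I : Set ℝ) (q : ℕ) (a ε₁ ε₂ : ℝ) : Type := Curve I q a ε₁ ε₂ → DiffPoly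

/-- The `𝒜`-local vector fields on `Λ`. -/
abbrev VectorField (I : Set ℝ) (q : ℕ) (a ε₁ ε₂ : ℝ) : Type := Curve I q a ε₁ ε₂ → LocalField

/-- The space `𝔛_𝒜(Λ)` of `𝒜`-local evolution vector fields. -/
def evolutionFields (I : Set ℝ) (q : ℕ) (a ε₁ ε₂ : ℝ) :
    Submodule ℝ (VectorField I q a ε₁ ε₂) where
  carrier := {V | ∀ γ, IsEvolution a ε₁ (V γ)}
  zero_mem' := fun γ => ⟨by simp, 0, by simp, by simp⟩
  add_mem' := by
    intro V U hV hU γ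
    obtain ⟨h1, r, h2, h3⟩ := hV γ
    obtain ⟨h1', r', h2', h3'⟩ := hU γ
    refine ⟨?_, r + r', ?_, ?_⟩
    · simp only [Pi.add_apply, h1, h1', map_add, smul_add, neg_add]
    · simp only [Pi.add_apply, map_add, h2, h2', mul_add, smul_add]
      abel
    · simp only [Pi.add_apply, h3, h3', map_add, smul_add]
      abel
  smul_mem' := by
    intro c V hV γ
    obtain ⟨h1, r, h2, h3⟩ := hV γ
    refine ⟨?_, c • r, ?_, ?_⟩
    · simp only [Pi.smul_apply, h1, Derivation.map_smul, smul_neg, smul_comm c]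
    · simp only [Pi.smul_apply, Derivation.map_smul, h2, mul_smul_comm, smul_sub, smul_comm c]
    · simp only [Pi.smul_apply, h3, Derivation.map_smul, smul_add, smul_comm c]

/-- The evolution derivation `∂_{(p,r)}` of `𝒜`: `(∂_{(p,r)} f)_γ = ∂_{(p_γ,r_γ)} f_γ`. -/
def evolDer {I : Set ℝ} {q : ℕ} {a ε₁ ε₂ : ℝ} (p r : ScalarField I q a ε₁ ε₂) :
    Derivation ℝ (ScalarField I q a ε₁ ε₂) (ScalarField I q a ε₁ ε₂) :=
  Derivation.mk'
    { toFun := fun f γ => evolPoly (p γ) (r γ) (f γ)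
      map_add' := fun f g => by ext1 γ; simp
      map_smul' := fun c f => by ext1 γ; simp }
    (fun f g => by ext1 γ; simp)

/-- The Lie bracket of pairs of scalar fields, first component:
`[(p, r), (p', r')]₁ = ∂_{(p,r)} p' - ∂_{(p',r')} p`. -/
def flowBracket {I : Set ℝ} {q : ℕ} {a ε₁ ε₂ : ℝ}
    (A B : ScalarField I q a ε₁ ε₂ × ScalarField I q a ε₁ ε₂) :
    ScalarField I q a ε₁ ε₂ × ScalarField I q a ε₁ ε₂ :=
  (evolDer A.1 A.2 B.1 - evolDer B.1 B.2 A.1, evolDer A.1 A.2 B.2 - evolDer B.1 B.2 A.2)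

theorem evolPoly_D (p r f : DiffPoly) : evolPoly p r (D f) = D (evolPoly p r f) := by
  have h : ⁅evolPoly p r, D⁆ = 0 := by
    refine MvPolynomial.derivation_ext fun v => ?_
    simp [Derivation.commutator_apply, evolPoly, D, MvPolynomial.mkDerivation_X,
      Function.iterate_succ_apply']
  have := DFunLike.congr_fun h f
  simpa [Derivation.commutator_apply, sub_eq_zero] using this

theorem evolPoly_commutator (p r p' r' : DiffPoly) :
    ⁅evolPoly p r, evolPoly p' r'⁆ =
      evolPoly (evolPoly p r p' - evolPoly p' r' p) (evolPoly p r r' - evolPoly p' r' r) := by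
  have key : ∀ (p r f : DiffPoly) (m : ℕ),
      evolPoly p r ((⇑D)^[m] f) = (⇑D)^[m] (evolPoly p r f) := by
    intro p r f m
    induction m with
    | zero => rfl
    | succ m ih => rw [Function.iterate_succ_apply', evolPoly_D, ih, Function.iterate_succ_apply']
  have hsub : ∀ (m : ℕ) (f g : DiffPoly), (⇑D)^[m] (f - g) = (⇑D)^[m] f - (⇑D)^[m] g :=
    fun m f g => iterate_map_sub D m f g
  have hX : ∀ (p r : DiffPoly) (v : Fin 2 × ℕ),
      evolPoly p r (MvPolynomial.X v) = (⇑D)^[v.2] (![p, r] v.1) :=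
    fun p r v => MvPolynomial.mkDerivation_X ℝ _ v
  refine MvPolynomial.derivation_ext fun v => ?_
  obtain ⟨i, m⟩ := v
  rw [Derivation.commutator_apply, hX, hX, hX, key, key, ← hsub]
  fin_cases i <;> rfl

theorem evolDer_commutator {I : Set ℝ} {q : ℕ} {a ε₁ ε₂ : ℝ}
    (A B : ScalarField I q a ε₁ ε₂ × ScalarField I q a ε₁ ε₂) :
    ⁅evolDer A.1 A.2, evolDer B.1 B.2⁆ = evolDer (flowBracket A B).1 (flowBracket A B).2 := by
  ext1 f
  funext γ
  exact DFunLike.congr_fun (evolPoly_commutator (A.1 γ) (A.2 γ) (B.1 γ) (B.2 γ)) (f γ)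

/-- `∂_{(p,r)}` depends linearly on `(p, r)`. -/
theorem evolPoly_add (p r p' r' f : DiffPoly) :
    evolPoly (p + p') (r + r') f = evolPoly p r f + evolPoly p' r' f := by
  have h : evolPoly (p + p') (r + r') = evolPoly p r + evolPoly p' r' := by
    refine MvPolynomial.derivation_ext fun v => ?_
    obtain ⟨i, m⟩ := v
    fin_cases i <;> simp [evolPoly, MvPolynomial.mkDerivation_X, iterate_map_add]
  rw [h, Derivation.add_apply]

theorem evolPoly_smul (c : ℝ) (p r f : DiffPoly) :
    evolPoly (c • p) (c • r) f = c • evolPoly p r f := by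
  have hs : ∀ (m : ℕ) (g : DiffPoly), (⇑D)^[m] (c • g) = c • (⇑D)^[m] g := by
    intro m g
    induction m with
    | zero => rfl
    | succ m ih =>
      rw [Function.iterate_succ_apply', ih, Derivation.map_smul, Function.iterate_succ_apply']
  have h : evolPoly (c • p) (c • r) = c • evolPoly p r := by
    refine MvPolynomial.derivation_ext fun v => ?_
    obtain ⟨i, m⟩ := v
    fin_cases i <;> simp [evolPoly, MvPolynomial.mkDerivation_X, hs]
  rw [h, Derivation.smul_apply]

/-- The Lie algebra `der*(𝒜)` of all evolution derivations of `𝒜`, a Lie subalgebra of the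
derivations with the commutator. -/
def evolutionDerivations (I : Set ℝ) (q : ℕ) (a ε₁ ε₂ : ℝ) :
    LieSubalgebra ℝ
      (Derivation ℝ (ScalarField I q a ε₁ ε₂) (ScalarField I q a ε₁ ε₂)) where
  carrier := {d | ∃ p r : ScalarField I q a ε₁ ε₂, d = evolDer p r}
  zero_mem' := ⟨0, 0, by
    ext1 f; funext γ
    have := evolPoly_smul 0 0 0 (f γ)
    simp only [zero_smul] at this
    exact this.symm⟩
  add_mem' := by
    rintro _ _ ⟨p, r, rfl⟩ ⟨p', r', rfl⟩
    exact ⟨p + p', r + r', by ext1 f; funext γ; exact (evolPoly_add _ _ _ _ _).symm⟩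
  smul_mem' := by
    rintro c _ ⟨p, r, rfl⟩
    exact ⟨c • p, c • r, by ext1 f; funext γ; exact (evolPoly_smul _ _ _ _).symm⟩
  lie_mem' := by
    rintro _ _ ⟨p, r, rfl⟩ ⟨p', r', rfl⟩
    exact ⟨_, _, evolDer_commutator (p, r) (p', r')⟩

/-- The curvature flow `(V(k₁), V(k₂))` of a vector field on `Λ`. -/
def curvatureFlow {I : Set ℝ} {q : ℕ} {a ε₁ ε₂ : ℝ} (V : VectorField I q a ε₁ ε₂) :
    ScalarField I q a ε₁ ε₂ × ScalarField I q a ε₁ ε₂ :=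
  (fun γ => act a ε₁ ε₂ (V γ) κ₁, fun γ => act a ε₁ ε₂ (V γ) κ₂)

end

end NullCurve

open NullCurve

namespace NullCurve

open MvPolynomial

/-! ### Components of the covariant derivative and the evolution condition -/

variable {a ε₁ ε₂ : ℝ}

/-! The evolution condition says that `∇_T V` is orthogonal to `T` and `∇_T² V` to `W₁`. It forces
`ρ_V = 0`, so `V` acts on `𝒫` as an evolution derivation commuting with `D`. The formulas for
`V(k₁)`, `V(k₂)` and `D_V` of the frame then say that `D_V` is a tensor derivation compatible with
the scalar product and with `∇_T`: an infinitesimal isometry (`IsIsometric`). Moreover `D_V T = ∇_T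
V` (`covD_frame_zero`).

Infinitesimal isometries are closed under differences and commutators, and they are rigid: one that
kills `T` is zero (`IsIsometric.eq_zero`), because the Cartan equations produce the other frame
fields and the curvatures from `T`. Commuting `D_V` and `D_U` with `∇_T` gives `∇_T [V, U] = [D_V,
D_U] T`. Skew-symmetry of `[D_V, D_U]` shows that `[V, U]` is again an evolution field, and rigidity
gives `D_{[V,U]} = [D_V, D_U]`. This vanishing of curvature yields the Jacobi identity, the
homomorphism property, and the equivalence between commuting fields and commuting flows, once
injectivity is known.

For injectivity, comparing highest derivatives shows that `Θ` has no kernel in `𝒫`. Hence `φ_V = ψ_V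
= 0`, so `∇_T V = D_V T = 0`, and a parallel `𝒫`-local field is zero by the same descent on orders.

Faithfulness is the fundamental theorem of curves: any smooth curvatures on the line are realized on
`I` by a null curve, so the jet of the curvatures at a point is arbitrary to any finite order, and a
polynomial vanishing at all such jets is zero. -/

theorem phi_eq (h₁ : ε₁ * ε₁ = 1) (V : LocalField) :
    phi a ε₁ ε₂ V = nabla a ε₁ ε₂ V 1 := by
  simp [phi, pair, frame, smul_smul, h₁]

theorem psi_eq (h₂ : ε₂ * ε₂ = 1) (V : LocalField) :
    psi a ε₁ ε₂ V = nabla a ε₁ ε₂ V 3 := by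
  simp [psi, pair, frame, smul_smul, h₂]

theorem rho_eq (h₁ : ε₁ * ε₁ = 1) (V : LocalField) :
    rho a ε₁ ε₂ V = -nabla a ε₁ ε₂ (nabla a ε₁ ε₂ V) 1 := by
  simp [rho, pair, frame, smul_smul, h₁]

theorem C_mul_C_inv {c : ℝ} (hc : c ≠ 0) : (C c : DiffPoly) * C c⁻¹ = 1 := by
  rw [← C_mul, mul_inv_cancel₀ hc, C_1]

theorem C_mul_C_self {c : ℝ} (hc : c * c = 1) : (C c : DiffPoly) * C c = 1 := by
  rw [← C_mul, hc, C_1]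

/-- The evolution condition says that `∇_T V` is orthogonal to `T` and `∇_T² V` to `W₁`. -/
theorem isEvolution_iff (ha : a ≠ 0) (h₁ : ε₁ * ε₁ = 1) (V : LocalField) :
    IsEvolution a ε₁ V ↔
      nabla a ε₁ ε₂ V 2 = 0 ∧ nabla a ε₁ ε₂ (nabla a ε₁ ε₂ V) 1 = 0 := by
  have hA := C_mul_C_inv ha
  have hE := C_mul_C_self h₁
  have h2 := C_mul_C_inv (two_ne_zero (α := ℝ))
  have h22 : (C 2 : DiffPoly) = 2 := map_ofNat C 2
  constructor
  · rintro ⟨hh, r, hr, hf⟩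
    -- Once `h` is substituted, the `W₁`-component of `∇_T² V` is `2a f' - (ε₁/a) g''' - ε₁ k₁' g +
    -- a k₂ l`, so its vanishing is the formula for `f` differentiated once.
    have e0 : D (V 0) = (1 / (2 * a)) • ((ε₁ / a) • D (D (D (V 2))) + D r) := by
      rw [hf]; simp
    have e2 : D (D (V 1)) = -((ε₁ / a) • D (D (D (V 2)))) := by rw [hh]; simp
    rw [hr] at e0
    constructor
    · simp only [nabla, Matrix.cons_val, hh]
      simp only [smul_eq_C_mul, div_eq_mul_inv, C_mul]
      grind
    · simp only [nabla, Matrix.cons_val, map_add, map_sub, Derivation.map_smul, Derivation.leibniz,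
        smul_eq_mul, e0, e2]
      rw [hh]
      simp only [smul_eq_C_mul, div_eq_mul_inv, mul_inv, C_mul, one_mul]
      grind
  · rintro ⟨hg, hw⟩
    have hh : V 1 = -((ε₁ / a) • D (V 2)) := by
      simp only [nabla, Matrix.cons_val] at hg
      simp only [smul_eq_C_mul, div_eq_mul_inv, C_mul] at hg ⊢
      grind
    have e2 : D (D (V 1)) = -((ε₁ / a) • D (D (D (V 2)))) := by rw [hh]; simp
    -- The antiderivative is obtained by solving the formula for `f`.
    refine ⟨hh, (2 * a) • V 0 - (ε₁ / a) • D (D (V 2)), ?_, ?_⟩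
    · simp only [nabla, Matrix.cons_val, map_add, map_sub, Derivation.map_smul, Derivation.leibniz,
        smul_eq_mul, e2] at hw
      rw [hh] at hw
      simp only [map_sub, Derivation.map_smul]
      simp only [smul_eq_C_mul, div_eq_mul_inv, C_mul] at hw ⊢
      grind
    · simp only [smul_eq_C_mul, div_eq_mul_inv, mul_inv, C_mul, one_mul]
      grind

theorem IsEvolution.rho_eq_zero {V : LocalField} (ha : a ≠ 0) (h₁ : ε₁ * ε₁ = 1)
    (hV : IsEvolution a ε₁ V) : rho a ε₁ ε₂ V = 0 := by
  rw [rho_eq h₁, ((isEvolution_iff ha h₁ V).1 hV).2, neg_zero]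

theorem actGen_eq_iterate {V : LocalField} (hρ : rho a ε₁ ε₂ V = 0) (i : Fin 2) (m : ℕ) :
    actGen a ε₁ ε₂ V i m = (⇑D)^[m] (![actK₁ a ε₁ ε₂ V, actK₂ a ε₁ ε₂ V] i) := by
  induction m with
  | zero => rfl
  | succ m ih => rw [Function.iterate_succ_apply', ← ih, actGen, hρ]; simp

/-- With `ρ_V = 0` the correction term in `V(f') = V(f)' + (1/2a) ρ_V f'` disappears. Commutation of
`V` with `D` then follows from `evolPoly_D`. -/
theorem act_eq_evolPoly {V : LocalField} (hρ : rho a ε₁ ε₂ V = 0) :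
    act a ε₁ ε₂ V = evolPoly (actK₁ a ε₁ ε₂ V) (actK₂ a ε₁ ε₂ V) := by
  refine MvPolynomial.derivation_ext fun v => ?_
  simp [act, evolPoly, mkDerivation_X, actGen_eq_iterate hρ]

theorem act_κ₁ (V : LocalField) : act a ε₁ ε₂ V κ₁ = actK₁ a ε₁ ε₂ V := by
  simp [act, κ₁, mkDerivation_X, actGen]

theorem act_κ₂ (V : LocalField) : act a ε₁ ε₂ V κ₂ = actK₂ a ε₁ ε₂ V := by
  simp [act, κ₂, mkDerivation_X, actGen]

theorem covD_apply (V U : LocalField) (j : Fin 4) :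
    covD a ε₁ ε₂ V U j = act a ε₁ ε₂ V (U j) + (U 0 * covFrame a ε₁ ε₂ V 0 j +
      U 1 * covFrame a ε₁ ε₂ V 1 j + U 2 * covFrame a ε₁ ε₂ V 2 j +
      U 3 * covFrame a ε₁ ε₂ V 3 j) := by
  fin_cases j <;> simp [covD, Fin.sum_univ_four, frame] <;> ring

/-! ### Infinitesimal isometries and their rigidity -/

/-- A derivation `d` of `𝒫` together with a tensor derivation `Δ` of local vector fields over it
that is compatible with the total derivative, the scalar product and `∇_T`. -/
structure IsIsometric (a ε₁ ε₂ : ℝ) (d : Derivation ℝ DiffPoly DiffPoly)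
    (Δ : LocalField → LocalField) : Prop where
  map_D : ∀ f, d (D f) = D (d f)
  map_add : ∀ X Y, Δ (X + Y) = Δ X + Δ Y
  map_smul : ∀ (f : DiffPoly) X, Δ (f • X) = d f • X + f • Δ X
  map_pair : ∀ X Y, d (pair ε₁ ε₂ X Y) = pair ε₁ ε₂ (Δ X) Y + pair ε₁ ε₂ X (Δ Y)
  map_nabla : ∀ X, Δ (nabla a ε₁ ε₂ X) = nabla a ε₁ ε₂ (Δ X)

/-- The coefficients of `D_V` in the frame are skew for the Gram matrix of the frame; neither the
evolution condition nor `ρ_V = 0` is needed. -/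
theorem covD_pair (h₁ : ε₁ * ε₁ = 1) (h₂ : ε₂ * ε₂ = 1) (V X Y : LocalField) :
    act a ε₁ ε₂ V (pair ε₁ ε₂ X Y) =
      pair ε₁ ε₂ (covD a ε₁ ε₂ V X) Y + pair ε₁ ε₂ X (covD a ε₁ ε₂ V Y) := by
  have hE := C_mul_C_self h₁
  have hE' := C_mul_C_self h₂
  simp only [pair, covD_apply, covFrame, Matrix.cons_val, Derivation.map_smul, Derivation.leibniz,
    _root_.map_add, map_neg, smul_eq_mul]
  simp only [smul_eq_C_mul, div_eq_mul_inv, C_mul]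
  grind

/-- This is where the shape of `V(k₁)`, `V(k₂)`, `α_V`, `β_V` and `δ_V` is used: they are what makes
`D_V` respect the four Cartan equations when `ρ_V = 0`. -/
theorem covD_nabla (ha : a ≠ 0) (h₁ : ε₁ * ε₁ = 1) (h₂ : ε₂ * ε₂ = 1) {V : LocalField}
    (hV : rho a ε₁ ε₂ V = 0) (X : LocalField) :
    covD a ε₁ ε₂ V (nabla a ε₁ ε₂ X) = nabla a ε₁ ε₂ (covD a ε₁ ε₂ V X) := by
  have hA := C_mul_C_inv ha
  have hE := C_mul_C_self h₁
  have hE' := C_mul_C_self h₂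
  have hD : ∀ f, act a ε₁ ε₂ V (D f) = D (act a ε₁ ε₂ V f) := fun f => by
    rw [act_eq_evolPoly hV, evolPoly_D]
  ext1 j
  rw [covD_apply]
  fin_cases j <;>
  · simp only [nabla, covD_apply, covFrame, Matrix.cons_val, Derivation.map_smul,
      Derivation.leibniz, _root_.map_add, map_sub, map_neg, smul_eq_mul, hD, act_κ₁, act_κ₂,
      actK₁, actK₂, hV, alpha, beta, delta, theta, opS, map_zero, mul_zero, smul_zero, add_zero,
      Fin.zero_eta, Fin.mk_one, Fin.reduceFinMk]
    simp only [smul_eq_C_mul, div_eq_mul_inv, C_mul, one_mul]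
    grind

theorem covD_isIsometric (ha : a ≠ 0) (h₁ : ε₁ * ε₁ = 1) (h₂ : ε₂ * ε₂ = 1) {V : LocalField}
    (hV : rho a ε₁ ε₂ V = 0) :
    IsIsometric a ε₁ ε₂ (act a ε₁ ε₂ V) (covD a ε₁ ε₂ V) where
  map_D f := by rw [act_eq_evolPoly hV, evolPoly_D]
  map_add X Y := by ext1 j; simp only [covD_apply, Pi.add_apply, map_add]; ring
  map_smul f X := by
    ext1 j
    simp only [covD_apply, Pi.add_apply, Pi.smul_apply, smul_eq_mul, Derivation.leibniz]
    ring
  map_pair := covD_pair h₁ h₂ V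
  map_nabla := covD_nabla ha h₁ h₂ hV

theorem nabla_add (X Y : LocalField) :
    nabla a ε₁ ε₂ (X + Y) = nabla a ε₁ ε₂ X + nabla a ε₁ ε₂ Y := by
  ext1 j
  fin_cases j <;> simp [nabla, smul_add, mul_add] <;> ring

theorem nabla_smul_real (c : ℝ) (X : LocalField) :
    nabla a ε₁ ε₂ (c • X) = c • nabla a ε₁ ε₂ X := by
  ext1 j
  fin_cases j <;> simp [nabla, smul_eq_C_mul] <;> ring

theorem nabla_sub (X Y : LocalField) :
    nabla a ε₁ ε₂ (X - Y) = nabla a ε₁ ε₂ X - nabla a ε₁ ε₂ Y := by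
  rw [sub_eq_add_neg, nabla_add, ← neg_one_smul ℝ Y, nabla_smul_real, neg_one_smul, ← sub_eq_add_neg]

theorem pair_sub_left (X Y Z : LocalField) :
    pair ε₁ ε₂ (X - Y) Z = pair ε₁ ε₂ X Z - pair ε₁ ε₂ Y Z := by
  simp only [pair, Pi.sub_apply, smul_eq_C_mul]; ring

theorem pair_sub_right (X Y Z : LocalField) :
    pair ε₁ ε₂ X (Y - Z) = pair ε₁ ε₂ X Y - pair ε₁ ε₂ X Z := by
  simp only [pair, Pi.sub_apply, smul_eq_C_mul]; ring

theorem pair_add_left (X Y Z : LocalField) :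
    pair ε₁ ε₂ (X + Y) Z = pair ε₁ ε₂ X Z + pair ε₁ ε₂ Y Z := by
  simp only [pair, Pi.add_apply, smul_eq_C_mul]; ring

theorem pair_frame_zero (X : LocalField) : pair ε₁ ε₂ X (frame 0) = -X 2 := by
  simp [pair, frame]

theorem pair_frame_one (X : LocalField) : pair ε₁ ε₂ X (frame 1) = ε₁ • X 1 := by
  simp [pair, frame]

theorem pair_frame_two (X : LocalField) : pair ε₁ ε₂ X (frame 2) = -X 0 := by
  simp [pair, frame]

theorem pair_frame_three (X : LocalField) : pair ε₁ ε₂ X (frame 3) = ε₂ • X 3 := by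
  simp [pair, frame]

theorem pair_comm (X Y : LocalField) : pair ε₁ ε₂ X Y = pair ε₁ ε₂ Y X := by
  simp only [pair, smul_eq_C_mul]; ring

theorem nabla_frame_zero : nabla a ε₁ ε₂ (frame 0) = a • frame 1 := by
  ext1 j; fin_cases j <;> simp [nabla, frame]

theorem nabla_frame_one :
    nabla a ε₁ ε₂ (frame 1) = (-κ₁) • frame 0 + (a * ε₁) • frame 2 := by
  ext1 j; fin_cases j <;> simp [nabla, frame, mul_comm]

theorem nabla_frame_two :
    nabla a ε₁ ε₂ (frame 2) = (-(ε₁ • κ₁)) • frame 1 + (ε₂ • κ₂) • frame 3 := by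
  ext1 j; fin_cases j <;> simp [nabla, frame]

theorem eq_sum_frame (X : LocalField) :
    X = X 0 • frame 0 + X 1 • frame 1 + X 2 • frame 2 + X 3 • frame 3 := by
  ext1 j; fin_cases j <;> simp [frame]

namespace IsIsometric

variable {d d' : Derivation ℝ DiffPoly DiffPoly} {Δ Δ' : LocalField → LocalField}

theorem sub (h : IsIsometric a ε₁ ε₂ d Δ) (h' : IsIsometric a ε₁ ε₂ d' Δ') :
    IsIsometric a ε₁ ε₂ (d - d') (fun X => Δ X - Δ' X) where
  map_D f := by simp [h.map_D, h'.map_D]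
  map_add X Y := by rw [h.map_add, h'.map_add]; abel
  map_smul f X := by
    rw [h.map_smul, h'.map_smul, Derivation.sub_apply, sub_smul, smul_sub]; abel
  map_pair X Y := by
    rw [Derivation.sub_apply, h.map_pair, h'.map_pair, pair_sub_left, pair_sub_right]; ring
  map_nabla X := by rw [h.map_nabla, h'.map_nabla, nabla_sub]

theorem map_real_smul (h : IsIsometric a ε₁ ε₂ d Δ) (c : ℝ) (X : LocalField) :
    Δ (c • X) = c • Δ X := by
  have e : ∀ Z : LocalField, c • Z = (C c : DiffPoly) • Z := fun Z => by
    ext1 j; simp [smul_eq_C_mul]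
  rw [e, e, h.map_smul, ← algebraMap_eq, Derivation.map_algebraMap, zero_smul, zero_add]

theorem map_zero (h : IsIsometric a ε₁ ε₂ d Δ) : Δ 0 = 0 := by
  simpa using h.map_real_smul 0 0

theorem map_sub (h : IsIsometric a ε₁ ε₂ d Δ) (X Y : LocalField) : Δ (X - Y) = Δ X - Δ Y := by
  rw [sub_eq_add_neg, h.map_add, ← neg_one_smul ℝ Y, h.map_real_smul, neg_one_smul,
    ← sub_eq_add_neg]

/-- The mixed terms of the two Leibniz rules are symmetric in the two derivations and cancel. -/
theorem commutator (h : IsIsometric a ε₁ ε₂ d Δ) (h' : IsIsometric a ε₁ ε₂ d' Δ') :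
    IsIsometric a ε₁ ε₂ ⁅d, d'⁆ (fun X => Δ (Δ' X) - Δ' (Δ X)) where
  map_D f := by simp [Derivation.commutator_apply, h.map_D, h'.map_D]
  map_add X Y := by simp only [h.map_add, h'.map_add]; abel
  map_smul f X := by
    simp only [h.map_smul, h'.map_smul, h.map_add, h'.map_add, Derivation.commutator_apply,
      sub_smul, smul_sub]
    abel
  map_pair X Y := by
    simp only [Derivation.commutator_apply, h.map_pair, h'.map_pair, _root_.map_add, pair_sub_left,
      pair_sub_right]
    ring
  map_nabla X := by rw [h.map_nabla, h'.map_nabla, h.map_nabla, h'.map_nabla, nabla_sub]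

/-- The image of a frame field `X` of constant length is orthogonal to `X`. -/
theorem pair_self (h : IsIsometric a ε₁ ε₂ d Δ) (i : Fin 4) :
    pair ε₁ ε₂ (Δ (frame i)) (frame i) = 0 := by
  have e : d (pair ε₁ ε₂ (frame i) (frame i)) = 0 := by
    fin_cases i <;> simp [pair, frame]
  rw [h.map_pair, pair_comm (frame i), ← two_mul] at e
  simpa using e

/-- Each Cartan equation passes the vanishing on: `T' = a W₁` to `W₁`, then `W₁'` to `k₁` and `N`,
then `N'` to `k₂` and `W₂`. When a frame field and a curvature appear together, skew-symmetry
separates them. -/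
theorem eq_zero (h : IsIsometric a ε₁ ε₂ d Δ) (ha : a ≠ 0) (h₁ : ε₁ * ε₁ = 1)
    (h₂ : ε₂ * ε₂ = 1) (hT : Δ (frame 0) = 0) : d = 0 ∧ ∀ X, Δ X = 0 := by
  have e₁ : ε₁ ≠ 0 := by rintro rfl; simp at h₁
  have e₂ : ε₂ ≠ 0 := by rintro rfl; simp at h₂
  have hW₁ : Δ (frame 1) = 0 := by
    have := h.map_nabla (frame 0)
    rw [hT, nabla_frame_zero, h.map_real_smul, ← zero_smul ℝ 0, nabla_smul_real, zero_smul] at this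
    exact (smul_eq_zero.1 this).resolve_left ha
  have hn0 : nabla a ε₁ ε₂ 0 = 0 := by
    rw [← zero_smul ℝ 0, nabla_smul_real, zero_smul, zero_smul]
  have k1 := h.map_nabla (frame 1)
  rw [hW₁, hn0, nabla_frame_one, h.map_add, h.map_smul, h.map_real_smul, hT] at k1
  -- The equation for `W₁'` reads `-d(k₁) T + a ε₁ ΔN = 0`. Since `N` is null and `⟨ΔN, N⟩ = 0`,
  -- `ΔN` has no `T`-component, so both terms vanish.
  have hN0 := h.pair_self 2
  have hN : Δ (frame 2) 0 = 0 := neg_eq_zero.1 (pair_frame_two (ε₁ := ε₁) (ε₂ := ε₂) _ ▸ hN0)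
  have hκ₁ : d κ₁ = 0 := by
    have := congrFun k1 0
    rw [frame] at hN
    simpa [frame, hN] using this
  have hN : Δ (frame 2) = 0 := by
    rw [_root_.map_neg, hκ₁] at k1
    simpa [ha, e₁] using k1
  have k2 := h.map_nabla (frame 2)
  rw [hN, hn0, nabla_frame_two, h.map_add, h.map_smul, h.map_smul, hW₁] at k2
  -- Likewise `ΔW₂` has no `W₂`-component, which isolates `d(k₂)`; what remains is `k₂ ΔW₂ = 0` up
  -- to a nonzero constant, and `k₂` can be cancelled in the domain `𝒫`.
  have hW0 := h.pair_self 3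
  have hW : Δ (frame 3) 3 = 0 := by
    rw [pair_frame_three] at hW0
    exact (smul_eq_zero.1 hW0).resolve_left e₂
  have hκ₂ : d κ₂ = 0 := by
    have := congrFun k2 3
    rw [frame] at hW
    simpa [frame, hW, e₂] using this
  have hW : Δ (frame 3) = 0 := by
    have hk : κ₂ ≠ 0 := X_ne_zero _
    simpa [hκ₁, hκ₂, e₂, hk] using k2
  have hd : d = 0 := by
    refine derivation_ext fun v => ?_
    obtain ⟨i, m⟩ := v
    rw [Derivation.zero_apply]
    induction m with
    | zero => fin_cases i <;> assumption
    | succ m ih =>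
      have : (X (i, m + 1) : DiffPoly) = D (X (i, m)) := by simp [D, mkDerivation_X]
      rw [this, h.map_D, ih, _root_.map_zero]
  refine ⟨hd, fun X => ?_⟩
  rw [eq_sum_frame X]
  simp only [h.map_add, h.map_smul, hT, hW₁, hN, hW, hd, Derivation.zero_apply, zero_smul,
    smul_zero, add_zero]

end IsIsometric

/-! ### The bracket of evolution fields -/

theorem nabla_apply_one (X : LocalField) :
    nabla a ε₁ ε₂ X 1 = a • X 0 + D (X 1) - ε₁ • (κ₁ * X 2) := by
  simp only [nabla, Matrix.cons_val]

/-- The two evolution conditions are the two components that do not match by definition: the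
`N`-component is zero, and orthogonality of `∇_T² V` to `W₁` makes the `T`-component equal to
`-φ_V'/a = -α_V`. -/
theorem covD_frame_zero (ha : a ≠ 0) (h₁ : ε₁ * ε₁ = 1) (h₂ : ε₂ * ε₂ = 1) {V : LocalField}
    (hV : IsEvolution a ε₁ V) : covD a ε₁ ε₂ V (frame 0) = nabla a ε₁ ε₂ V := by
  obtain ⟨hg, hw⟩ := (isEvolution_iff (ε₂ := ε₂) ha h₁ V).1 hV
  have hα : nabla a ε₁ ε₂ V 0 = -alpha a ε₁ ε₂ V := by
    rw [alpha, hV.rho_eq_zero ha h₁, phi_eq h₁]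
    rw [nabla_apply_one, hg, mul_zero, smul_zero, sub_zero] at hw
    rw [smul_zero, add_zero, eq_neg_of_add_eq_zero_right hw, smul_neg, neg_neg, smul_smul,
      one_div_mul_cancel ha, one_smul]
  have hf : ∀ j, covD a ε₁ ε₂ V (frame 0) j = covFrame a ε₁ ε₂ V 0 j := fun j => by
    rw [covD_apply]
    fin_cases j <;> simp [frame]
  ext1 j
  rw [hf, covFrame]
  fin_cases j
  · exact hα.symm
  · exact phi_eq h₁ V
  · exact hg.symm
  · exact psi_eq h₂ V

theorem nabla_bracket (ha : a ≠ 0) (h₁ : ε₁ * ε₁ = 1) (h₂ : ε₂ * ε₂ = 1) {V U : LocalField}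
    (hV : IsEvolution a ε₁ V) (hU : IsEvolution a ε₁ U) :
    nabla a ε₁ ε₂ (bracket a ε₁ ε₂ V U) =
      covD a ε₁ ε₂ V (covD a ε₁ ε₂ U (frame 0)) - covD a ε₁ ε₂ U (covD a ε₁ ε₂ V (frame 0)) := by
  rw [bracket, nabla_sub, covD_frame_zero ha h₁ h₂ hV, covD_frame_zero ha h₁ h₂ hU,
    covD_nabla ha h₁ h₂ (hV.rho_eq_zero ha h₁), covD_nabla ha h₁ h₂ (hU.rho_eq_zero ha h₁)]

/-- Let `Δ = [D_V, D_U]`, so that `∇_T [V, U] = ΔT`. Then `⟨ΔT, T⟩ = 0` by skew-symmetry, and `∇_T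
ΔT = Δ(∇_T T) = a ΔW₁` is orthogonal to `W₁` for the same reason. -/
theorem IsEvolution.bracket (ha : a ≠ 0) (h₁ : ε₁ * ε₁ = 1) (h₂ : ε₂ * ε₂ = 1) {V U : LocalField}
    (hV : IsEvolution a ε₁ V) (hU : IsEvolution a ε₁ U) :
    IsEvolution a ε₁ (bracket a ε₁ ε₂ V U) := by
  have e₁ : ε₁ ≠ 0 := by rintro rfl; simp at h₁
  have hE := (covD_isIsometric ha h₁ h₂ (hV.rho_eq_zero ha h₁)).commutator
    (covD_isIsometric ha h₁ h₂ (hU.rho_eq_zero ha h₁))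
  rw [isEvolution_iff (ε₂ := ε₂) ha h₁, nabla_bracket ha h₁ h₂ hV hU]
  have p0 := hE.pair_self 0
  have p1 := hE.pair_self 1
  have hn := hE.map_nabla (frame 0)
  rw [nabla_frame_zero, hE.map_real_smul] at hn
  rw [pair_frame_zero] at p0
  rw [pair_frame_one] at p1
  refine ⟨neg_eq_zero.1 p0, (congrFun hn 1).symm.trans ?_⟩
  rw [Pi.smul_apply, (smul_eq_zero.1 p1).resolve_left e₁, smul_zero]

/-- Both sides are infinitesimal isometries with the same value `∇_T [V, U]` on `T`, so rigidity
applies to their difference. -/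
theorem act_bracket_and_covD_bracket (ha : a ≠ 0) (h₁ : ε₁ * ε₁ = 1) (h₂ : ε₂ * ε₂ = 1)
    {V U : LocalField} (hV : IsEvolution a ε₁ V) (hU : IsEvolution a ε₁ U) :
    act a ε₁ ε₂ (bracket a ε₁ ε₂ V U) = ⁅act a ε₁ ε₂ V, act a ε₁ ε₂ U⁆ ∧
      ∀ X, covD a ε₁ ε₂ (bracket a ε₁ ε₂ V U) X =
        covD a ε₁ ε₂ V (covD a ε₁ ε₂ U X) - covD a ε₁ ε₂ U (covD a ε₁ ε₂ V X) := by
  have hW := hV.bracket (ε₂ := ε₂) ha h₁ h₂ hU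
  have hE := (covD_isIsometric ha h₁ h₂ (hV.rho_eq_zero ha h₁)).commutator
    (covD_isIsometric ha h₁ h₂ (hU.rho_eq_zero ha h₁))
  have h := ((covD_isIsometric ha h₁ h₂ (hW.rho_eq_zero ha h₁)).sub hE).eq_zero ha h₁ h₂ (by
    rw [covD_frame_zero ha h₁ h₂ hW, nabla_bracket ha h₁ h₂ hV hU, sub_self])
  exact ⟨sub_eq_zero.1 h.1, fun X => sub_eq_zero.1 (h.2 X)⟩

theorem bracket_self (V : LocalField) : bracket a ε₁ ε₂ V V = 0 := sub_self _

theorem bracket_jacobi (ha : a ≠ 0) (h₁ : ε₁ * ε₁ = 1) (h₂ : ε₂ * ε₂ = 1) {V U W : LocalField}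
    (hV : IsEvolution a ε₁ V) (hU : IsEvolution a ε₁ U) (hW : IsEvolution a ε₁ W) :
    bracket a ε₁ ε₂ V (bracket a ε₁ ε₂ U W) + bracket a ε₁ ε₂ U (bracket a ε₁ ε₂ W V) +
      bracket a ε₁ ε₂ W (bracket a ε₁ ε₂ V U) = 0 := by
  have iV := covD_isIsometric ha h₁ h₂ (hV.rho_eq_zero (ε₂ := ε₂) ha h₁)
  have iU := covD_isIsometric ha h₁ h₂ (hU.rho_eq_zero (ε₂ := ε₂) ha h₁)
  have iW := covD_isIsometric ha h₁ h₂ (hW.rho_eq_zero (ε₂ := ε₂) ha h₁)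
  have e : ∀ X Y : LocalField,
      bracket a ε₁ ε₂ X Y = covD a ε₁ ε₂ X Y - covD a ε₁ ε₂ Y X := fun _ _ => rfl
  rw [e V, e U (bracket a ε₁ ε₂ W V), e W (bracket a ε₁ ε₂ V U),
    (act_bracket_and_covD_bracket ha h₁ h₂ hU hW).2, (act_bracket_and_covD_bracket ha h₁ h₂ hW hV).2,
    (act_bracket_and_covD_bracket ha h₁ h₂ hV hU).2, e U W, e W V, e V U, iV.map_sub, iU.map_sub,
    iW.map_sub]
  abel

/-! ### Linearity -/

theorem phi_add (V U : LocalField) :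
    phi a ε₁ ε₂ (V + U) = phi a ε₁ ε₂ V + phi a ε₁ ε₂ U := by
  simp only [phi, nabla_add, pair_add_left, smul_add]

theorem psi_add (V U : LocalField) :
    psi a ε₁ ε₂ (V + U) = psi a ε₁ ε₂ V + psi a ε₁ ε₂ U := by
  simp only [psi, nabla_add, pair_add_left, smul_add]

theorem rho_add (V U : LocalField) :
    rho a ε₁ ε₂ (V + U) = rho a ε₁ ε₂ V + rho a ε₁ ε₂ U := by
  simp only [rho, nabla_add, pair_add_left, smul_add, neg_add]

theorem pair_real_smul_left (c : ℝ) (X Y : LocalField) :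
    pair ε₁ ε₂ (c • X) Y = c • pair ε₁ ε₂ X Y := by
  simp only [pair, Pi.smul_apply, smul_eq_C_mul]; ring

theorem phi_smul (c : ℝ) (V : LocalField) : phi a ε₁ ε₂ (c • V) = c • phi a ε₁ ε₂ V := by
  simp only [phi, nabla_smul_real, pair_real_smul_left, smul_comm c]

theorem psi_smul (c : ℝ) (V : LocalField) : psi a ε₁ ε₂ (c • V) = c • psi a ε₁ ε₂ V := by
  simp only [psi, nabla_smul_real, pair_real_smul_left, smul_comm c]

theorem rho_smul (c : ℝ) (V : LocalField) : rho a ε₁ ε₂ (c • V) = c • rho a ε₁ ε₂ V := by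
  simp only [rho, nabla_smul_real, pair_real_smul_left, smul_comm c, smul_neg]

theorem actGen_add (V U : LocalField) (i : Fin 2) (m : ℕ) :
    actGen a ε₁ ε₂ (V + U) i m = actGen a ε₁ ε₂ V i m + actGen a ε₁ ε₂ U i m := by
  induction m with
  | zero =>
    fin_cases i <;>
    · simp only [actGen, actK₁, actK₂, theta, opS, phi_add, psi_add, rho_add, map_add, mul_add,
        Matrix.cons_val, Fin.zero_eta, Fin.mk_one, smul_eq_C_mul]
      ring
  | succ m ih => rw [actGen, actGen, actGen, ih, map_add, rho_add, add_mul, smul_add]; abel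

theorem actGen_smul (c : ℝ) (V : LocalField) (i : Fin 2) (m : ℕ) :
    actGen a ε₁ ε₂ (c • V) i m = c • actGen a ε₁ ε₂ V i m := by
  induction m with
  | zero =>
    fin_cases i <;>
    · simp only [actGen, actK₁, actK₂, theta, opS, phi_smul, psi_smul, rho_smul,
        Derivation.map_smul, mul_smul_comm,
        Matrix.cons_val, Fin.zero_eta, Fin.mk_one]
      simp only [smul_eq_C_mul]
      ring
  | succ m ih =>
    rw [actGen, actGen, ih, Derivation.map_smul, rho_smul, smul_mul_assoc, smul_comm _ c,
      ← smul_add]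

theorem act_add (V U : LocalField) : act a ε₁ ε₂ (V + U) = act a ε₁ ε₂ V + act a ε₁ ε₂ U :=
  derivation_ext fun v => by simp [act, mkDerivation_X, actGen_add]

theorem act_smul (c : ℝ) (V : LocalField) : act a ε₁ ε₂ (c • V) = c • act a ε₁ ε₂ V :=
  derivation_ext fun v => by simp [act, mkDerivation_X, actGen_smul]

theorem alpha_add (V U : LocalField) :
    alpha a ε₁ ε₂ (V + U) = alpha a ε₁ ε₂ V + alpha a ε₁ ε₂ U := by
  simp only [alpha, phi_add, rho_add, map_add, smul_add]
  exact add_add_add_comm _ _ _ _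

theorem alpha_smul (c : ℝ) (V : LocalField) : alpha a ε₁ ε₂ (c • V) = c • alpha a ε₁ ε₂ V := by
  simp only [alpha, phi_smul, rho_smul, Derivation.map_smul,
    smul_add, smul_comm c]

theorem beta_add (V U : LocalField) :
    beta a ε₁ ε₂ (V + U) = beta a ε₁ ε₂ V + beta a ε₁ ε₂ U := by
  simp only [beta, alpha_add, phi_add, psi_add, map_add, mul_add]
  rw [← smul_add, add_add_add_comm, add_sub_add_comm]

theorem beta_smul (c : ℝ) (V : LocalField) : beta a ε₁ ε₂ (c • V) = c • beta a ε₁ ε₂ V := by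
  simp only [beta, alpha_smul, phi_smul, psi_smul, Derivation.map_smul,
    mul_smul_comm]
  rw [← smul_add, ← smul_sub, smul_comm]

theorem delta_add (V U : LocalField) :
    delta a ε₁ ε₂ (V + U) = delta a ε₁ ε₂ V + delta a ε₁ ε₂ U := by
  simp only [delta, phi_add, psi_add, map_add, mul_add, smul_add]
  rw [add_add_add_comm (_ • _) (_ • _) (κ₁ * _), add_add_add_comm]

theorem delta_smul (c : ℝ) (V : LocalField) : delta a ε₁ ε₂ (c • V) = c • delta a ε₁ ε₂ V := by
  simp only [delta, phi_smul, psi_smul, Derivation.map_smul,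
    mul_smul_comm, smul_add, smul_comm c]

theorem covFrame_add (V U : LocalField) (i j : Fin 4) :
    covFrame a ε₁ ε₂ (V + U) i j = covFrame a ε₁ ε₂ V i j + covFrame a ε₁ ε₂ U i j := by
  simp only [covFrame, alpha_add, beta_add, delta_add, phi_add, psi_add, map_add, smul_add, neg_add]
  fin_cases i <;> fin_cases j <;> simp

theorem covFrame_smul (c : ℝ) (V : LocalField) (i j : Fin 4) :
    covFrame a ε₁ ε₂ (c • V) i j = c • covFrame a ε₁ ε₂ V i j := by
  simp only [covFrame, alpha_smul, beta_smul, delta_smul, phi_smul, psi_smul, Derivation.map_smul,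
    smul_comm _ c]
  fin_cases i <;> fin_cases j <;> simp

theorem covD_add_left (V U X : LocalField) :
    covD a ε₁ ε₂ (V + U) X = covD a ε₁ ε₂ V X + covD a ε₁ ε₂ U X := by
  ext1 j
  simp only [covD_apply, Pi.add_apply, act_add, covFrame_add, Derivation.add_apply]
  ring

theorem covD_smul_left (c : ℝ) (V X : LocalField) :
    covD a ε₁ ε₂ (c • V) X = c • covD a ε₁ ε₂ V X := by
  ext1 j
  simp only [covD_apply, Pi.smul_apply, act_smul, covFrame_smul, Derivation.smul_apply]
  simp only [smul_eq_C_mul]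
  ring

theorem covD_add_right (V X Y : LocalField) :
    covD a ε₁ ε₂ V (X + Y) = covD a ε₁ ε₂ V X + covD a ε₁ ε₂ V Y := by
  ext1 j
  simp only [covD_apply, Pi.add_apply, map_add]
  ring

theorem covD_smul_right (c : ℝ) (V X : LocalField) :
    covD a ε₁ ε₂ V (c • X) = c • covD a ε₁ ε₂ V X := by
  ext1 j
  simp only [covD_apply, Pi.smul_apply, Derivation.map_smul]
  simp only [smul_eq_C_mul]
  ring

theorem bracket_add_left (V U X : LocalField) :
    bracket a ε₁ ε₂ (V + U) X = bracket a ε₁ ε₂ V X + bracket a ε₁ ε₂ U X := by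
  simp only [bracket, covD_add_left, covD_add_right]; abel

theorem bracket_add_right (X V U : LocalField) :
    bracket a ε₁ ε₂ X (V + U) = bracket a ε₁ ε₂ X V + bracket a ε₁ ε₂ X U := by
  simp only [bracket, covD_add_left, covD_add_right]; abel

theorem bracket_smul_left (c : ℝ) (V X : LocalField) :
    bracket a ε₁ ε₂ (c • V) X = c • bracket a ε₁ ε₂ V X := by
  simp only [bracket, covD_smul_left, covD_smul_right, smul_sub]

theorem bracket_smul_right (c : ℝ) (X V : LocalField) :
    bracket a ε₁ ε₂ X (c • V) = c • bracket a ε₁ ε₂ X V := by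
  simp only [bracket, covD_smul_left, covD_smul_right, smul_sub]

/-! ### Orders of differential polynomials, the kernel of `Θ` and parallel fields -/

theorem D_X (i : Fin 2) (m : ℕ) : D (X (i, m)) = X (i, m + 1) := mkDerivation_X _ _ _

/-- The commutator of `∂/∂k^(m+1)` with `D` is the derivation `∂/∂k^(m)`, as is seen on the
variables. -/
theorem pderiv_D_succ (i : Fin 2) (m : ℕ) (p : DiffPoly) :
    pderiv (i, m + 1) (D p) = D (pderiv (i, m + 1) p) + pderiv (i, m) p := by
  have h : ⁅(pderiv (i, m + 1) : Derivation ℝ DiffPoly DiffPoly), D⁆ = pderiv (i, m) := by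
    refine derivation_ext fun v => ?_
    obtain ⟨j, k⟩ := v
    simp only [Derivation.commutator_apply, D_X, pderiv_X, Pi.single_apply, Prod.mk.injEq,
      add_left_inj]
    split_ifs <;> simp_all
  have := DFunLike.congr_fun h p
  rw [Derivation.commutator_apply] at this
  rw [← this]; ring

theorem pderiv_D_zero (i : Fin 2) (p : DiffPoly) :
    pderiv (i, 0) (D p) = D (pderiv (i, 0) p) := by
  have h : ⁅(pderiv (i, 0) : Derivation ℝ DiffPoly DiffPoly), D⁆ = 0 := by
    refine derivation_ext fun v => ?_
    obtain ⟨j, k⟩ := v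
    simp only [Derivation.commutator_apply, D_X, pderiv_X, Pi.single_apply, Prod.mk.injEq]
    split_ifs <;> simp_all
  have := DFunLike.congr_fun h p
  rwa [Derivation.commutator_apply, Derivation.zero_apply, sub_eq_zero] at this

/-- `p` only involves derivatives of the curvatures of order less than `n`. -/
def OrderLT (n : ℕ) (p : DiffPoly) : Prop := ∀ (i : Fin 2) (m : ℕ), n ≤ m → pderiv (i, m) p = 0

theorem exists_orderLT (p : DiffPoly) : ∃ n, OrderLT n p :=
  ⟨p.vars.sup Prod.snd + 1, fun i m hm => pderiv_eq_zero_of_notMem_vars fun h => by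
    have : m ≤ p.vars.sup Prod.snd := Finset.le_sup (f := Prod.snd) h
    omega⟩

theorem OrderLT.mono {n n' : ℕ} {p : DiffPoly} (h : OrderLT n p) (hn : n ≤ n') : OrderLT n' p :=
  fun i m hm => h i m (hn.trans hm)

theorem OrderLT.D {n : ℕ} {p : DiffPoly} (h : OrderLT n p) : OrderLT (n + 1) (D p) := by
  rintro i (_ | m) hm
  · omega
  · rw [pderiv_D_succ, h i (m + 1) (by omega), h i m (by omega), map_zero, add_zero]

theorem OrderLT.pderiv_D {n : ℕ} {p : DiffPoly} (h : OrderLT (n + 1) p) (i : Fin 2) :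
    pderiv (i, n + 1) (NullCurve.D p) = pderiv (i, n) p := by
  rw [pderiv_D_succ, h i (n + 1) le_rfl, map_zero, zero_add]

/-- A property of orders that descends holds down to order zero. -/
theorem orderLT_zero_of_descent {P : ℕ → Prop} {n : ℕ} (hn : P n)
    (h : ∀ n, P (n + 1) → P n) : P 0 := by
  induction n with
  | zero => exact hn
  | succ n ih => exact ih (h n hn)

theorem OrderLT.of_succ {n : ℕ} {p : DiffPoly} (h : OrderLT (n + 1) p)
    (hn : ∀ i, pderiv (i, n) p = 0) : OrderLT n p := by
  intro i m hm
  rcases hm.eq_or_lt with rfl | hm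
  · exact hn i
  · exact h i m hm

theorem pderiv_κ₁_succ (i : Fin 2) (m : ℕ) : pderiv (i, m + 1) κ₁ = 0 :=
  pderiv_X_of_ne (by simp)

theorem pderiv_κ₂_succ (i : Fin 2) (m : ℕ) : pderiv (i, m + 1) κ₂ = 0 :=
  pderiv_X_of_ne (by simp)

/-- Only the `D³` term reaches order `n + 3`, and it carries the derivatives of `p` in the top
variables along unchanged, up to the factor `1/a`. -/
theorem pderiv_theta {n : ℕ} {p : DiffPoly} (h : OrderLT (n + 1) p) (i : Fin 2) :
    pderiv (i, n + 3) (theta a p) = (1 / a) • pderiv (i, n) p := by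
  have h1 : pderiv (i, n + 3) (D κ₁) = 0 := by
    rw [κ₁, D_X]; exact pderiv_X_of_ne (by simp)
  simp only [theta, map_add, Derivation.map_smul, Derivation.leibniz, smul_eq_mul,
    h.D.D.pderiv_D, h.D.pderiv_D, h.pderiv_D, h.D i (n + 3) (by omega), h i (n + 3) (by omega),
    pderiv_κ₁_succ, h1, mul_zero, add_zero]

theorem pderiv_opS {n : ℕ} {p : DiffPoly} (h : OrderLT (n + 1) p) (i : Fin 2) :
    pderiv (i, n + 3) (opS p) = 0 := by
  have h1 : pderiv (i, n + 3) (D κ₂) = 0 := by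
    rw [κ₂, D_X]; exact pderiv_X_of_ne (by simp)
  simp only [opS, map_add, Derivation.leibniz, smul_eq_mul,
    h.D i (n + 3) (by omega), h i (n + 3) (by omega),
    pderiv_κ₂_succ, h1, mul_zero, add_zero]

/-- The Hirota–Satsuma operator has trivial kernel on differential polynomials. -/
theorem hirotaSatsuma_kernel (ha : a ≠ 0) (h₁ : ε₁ * ε₁ = 1) (h₂ : ε₂ * ε₂ = 1) {p r : DiffPoly}
    (e₁ : theta a p - opS r = 0) (e₂ : opS p + (ε₁ * ε₂) • theta a r = 0) : p = 0 ∧ r = 0 := by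
  have hε : ε₁ * ε₂ ≠ 0 := by
    intro h
    have : (ε₁ * ε₁) * (ε₂ * ε₂) = 0 := by linear_combination (ε₁ * ε₂) * h
    simp [h₁, h₂] at this
  obtain ⟨n, hn⟩ := exists_orderLT p
  obtain ⟨n', hn'⟩ := exists_orderLT r
  -- In order `n + 3` the first equation sees only `p` and the second only `r`, since `S` raises
  -- orders by just one. So the top order of both can be lowered until they are constants.
  obtain ⟨hp, hr⟩ := orderLT_zero_of_descent (P := fun n => OrderLT n p ∧ OrderLT n r)
    (n := n + n') ⟨hn.mono (by omega), hn'.mono (by omega)⟩ fun n h => by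
      refine ⟨h.1.of_succ fun i => ?_, h.2.of_succ fun i => ?_⟩
      · have := congrArg (pderiv (i, n + 3)) e₁
        simpa [pderiv_theta h.1, pderiv_opS h.2, ha] using this
      · have := congrArg (pderiv (i, n + 3)) e₂
        rw [map_add, Derivation.map_smul, pderiv_theta h.2, pderiv_opS h.1] at this
        simpa [ha, mul_ne_zero_iff.1 hε] using this
  -- For constants, `θ p = k₁' p` and `S r = k₂' r`; differentiating by `k₁'` and `k₂'` separates
  -- `p` from `r`.
  have z : ∀ {f : DiffPoly}, OrderLT 0 f → ∀ i, pderiv (i, 1) (theta a f) = pderiv (i, 1) (D κ₁) * f := by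
    intro f hf i
    simp only [theta, map_add, Derivation.map_smul, Derivation.leibniz, smul_eq_mul, pderiv_D_succ,
      pderiv_D_zero, hf i 1 (by omega), hf i 0 le_rfl, map_zero, mul_zero, add_zero, zero_add,
      smul_zero, (show pderiv (i, 1) κ₁ = 0 from pderiv_κ₁_succ i 0), zero_mul, mul_comm]
  have z' : ∀ {f : DiffPoly}, OrderLT 0 f → ∀ i, pderiv (i, 1) (opS f) = pderiv (i, 1) (D κ₂) * f := by
    intro f hf i
    simp only [opS, map_add, Derivation.leibniz, smul_eq_mul, pderiv_D_succ,
      hf i 1 (by omega), hf i 0 le_rfl, map_zero, mul_zero, add_zero, zero_add,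
      (show pderiv (i, 1) κ₂ = 0 from pderiv_κ₂_succ i 0), zero_mul, mul_comm]
  have q : ∀ i, pderiv (i, 1) (D κ₁) * p - pderiv (i, 1) (D κ₂) * r = 0 := fun i => by
    rw [← z hp, ← z' hr, ← map_sub, e₁, map_zero]
  constructor
  · simpa [κ₁, κ₂, D_X, pderiv_X, Pi.single_apply] using q 0
  · simpa [κ₁, κ₂, D_X, pderiv_X, Pi.single_apply] using q 1

/-- There are no nonzero parallel local vector fields. -/
theorem nabla_kernel (ha : a ≠ 0) (h₂ : ε₂ * ε₂ = 1) {V : LocalField}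
    (hV : nabla a ε₁ ε₂ V = 0) : V = 0 := by
  have e2 : ε₂ ≠ 0 := by rintro rfl; simp at h₂
  have q0 : D (V 0) - κ₁ * V 1 + κ₂ * V 3 = 0 := congrFun hV 0
  have q1 : a • V 0 + D (V 1) - ε₁ • (κ₁ * V 2) = 0 := congrFun hV 1
  have q2 : (ε₁ * a) • V 1 + D (V 2) = 0 := congrFun hV 2
  have q3 : D (V 3) + ε₂ • (κ₂ * V 2) = 0 := congrFun hV 3
  choose n hn using fun j => exists_orderLT (V j)
  -- Each equation expresses the derivative of one component through undifferentiated components,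
  -- or, for `q1`, also `k₁` times one. Hence the derivative has no higher order than the
  -- components, and the orders descend to zero.
  have h0 := orderLT_zero_of_descent (P := fun n => ∀ j, OrderLT n (V j))
    (n := ∑ j, n j) (fun j => (hn j).mono (Finset.single_le_sum (fun _ _ => Nat.zero_le _)
      (Finset.mem_univ j))) fun n h j => (h j).of_succ fun i => by
      rw [← (h j).pderiv_D i]
      have z : ∀ j, pderiv (i, n + 1) (V j) = 0 := fun j => h j i (n + 1) le_rfl
      fin_cases j
      · have := congrArg (pderiv (i, n + 1)) q0
        simpa [z, pderiv_κ₁_succ, pderiv_κ₂_succ] using this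
      · have := congrArg (pderiv (i, n + 1)) q1
        simpa [z, pderiv_κ₁_succ, pderiv_κ₂_succ] using this
      · have := congrArg (pderiv (i, n + 1)) q2
        simpa [z, pderiv_κ₁_succ, pderiv_κ₂_succ] using this
      · have := congrArg (pderiv (i, n + 1)) q3
        simpa [z, pderiv_κ₁_succ, pderiv_κ₂_succ] using this
  have z : ∀ j i, pderiv (i, 0) (V j) = 0 := fun j i => h0 j i 0 le_rfl
  have d00 : pderiv (0, 0) κ₁ = 1 := pderiv_X_self _
  have d01 : pderiv (0, 0) κ₂ = 0 := pderiv_X_of_ne (by simp)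
  have d10 : pderiv (1, 0) κ₁ = 0 := pderiv_X_of_ne (by simp)
  have d11 : pderiv (1, 0) κ₂ = 1 := pderiv_X_self _
  -- The components are now constants, so they can be read off as coefficients of `k₁` and `k₂`.
  have v1 : V 1 = 0 := by
    have := congrArg (pderiv (0, 0)) q0
    simpa [z, d00, d01, pderiv_D_zero] using this
  have v3 : V 3 = 0 := by
    have := congrArg (pderiv (1, 0)) q0
    simpa [z, d10, d11, pderiv_D_zero] using this
  have v2 : V 2 = 0 := by
    have := congrArg (pderiv (1, 0)) q3
    simpa [z, d10, d11, pderiv_D_zero, e2] using this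
  have v0 : V 0 = 0 := by
    rw [v1, v2] at q1
    simpa [ha] using q1
  ext1 j
  fin_cases j <;> assumption

/-- Triviality of the kernel of `Θ` gives `φ_V = ψ_V = 0`, hence `α_V = 0` and `∇_T V = D_V T = 0`;
parallel fields vanish. -/
theorem IsEvolution.eq_zero_of_act (ha : a ≠ 0) (h₁ : ε₁ * ε₁ = 1) (h₂ : ε₂ * ε₂ = 1)
    {V : LocalField} (hV : IsEvolution a ε₁ V) (hκ₁ : act a ε₁ ε₂ V κ₁ = 0)
    (hκ₂ : act a ε₁ ε₂ V κ₂ = 0) : V = 0 := by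
  rw [act_κ₁, actK₁, hV.rho_eq_zero ha h₁] at hκ₁
  rw [act_κ₂, actK₂, hV.rho_eq_zero ha h₁] at hκ₂
  have hφψ := hirotaSatsuma_kernel (a := a) ha h₁ h₂ (p := phi a ε₁ ε₂ V) (r := psi a ε₁ ε₂ V)
    (by simpa [← smul_sub, ha] using hκ₁)
    (by
      rw [mul_zero, smul_zero, add_zero, show ε₁ * ε₂ / a = 1 / a * (ε₁ * ε₂) by ring, mul_smul,
        ← smul_add, smul_eq_zero] at hκ₂
      exact hκ₂.resolve_left (one_div_ne_zero ha))
  refine nabla_kernel ha h₂ (a := a) (ε₁ := ε₁) ?_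
  rw [← covD_frame_zero ha h₁ h₂ hV]
  ext1 j
  rw [covD_apply]
  fin_cases j <;> simp [frame, covFrame, alpha, hφψ.1, hφψ.2, hV.rho_eq_zero ha h₁]

theorem actK₁_eq_Theta₁ {V : LocalField} (hρ : rho a ε₁ ε₂ V = 0) :
    actK₁ a ε₁ ε₂ V = Theta₁ a (phi a ε₁ ε₂ V) (-psi a ε₁ ε₂ V) := by
  simp only [actK₁, Theta₁, opS, hρ, mul_neg, map_neg, map_zero, mul_zero, smul_zero, add_zero]
  rw [← smul_sub]; congr 1; abel

theorem actK₂_eq_Theta₂ {V : LocalField} (hρ : rho a ε₁ ε₂ V = 0) :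
    actK₂ a ε₁ ε₂ V = Theta₂ a ε₁ ε₂ (phi a ε₁ ε₂ V) (-psi a ε₁ ε₂ V) := by
  have : theta a (-psi a ε₁ ε₂ V) = -theta a (psi a ε₁ ε₂ V) := by
    simp only [theta, mul_neg, map_neg, smul_neg, neg_add]
  rw [actK₂, Theta₂, this, hρ, mul_zero, smul_zero, add_zero, smul_neg, sub_neg_eq_add, smul_add,
    smul_smul, one_div_mul_eq_div]

/-! ### The homomorphism to evolution derivations -/

section Global

variable {I : Set ℝ} {q : ℕ}

/-- The bracket of evolution vector fields. -/
noncomputable def evolutionBracket (I : Set ℝ) (q : ℕ) (ha : a ≠ 0) (h₁ : ε₁ * ε₁ = 1)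
    (h₂ : ε₂ * ε₂ = 1) :
    evolutionFields I q a ε₁ ε₂ →ₗ[ℝ] evolutionFields I q a ε₁ ε₂ →ₗ[ℝ]
      evolutionFields I q a ε₁ ε₂ :=
  LinearMap.mk₂ ℝ
    (fun V U => ⟨fun γ => bracket a ε₁ ε₂ (V.1 γ) (U.1 γ),
      fun γ => (V.2 γ).bracket ha h₁ h₂ (U.2 γ)⟩)
    (fun _ _ _ => Subtype.ext <| funext fun _ => bracket_add_left _ _ _)
    (fun _ _ _ => Subtype.ext <| funext fun _ => bracket_smul_left _ _ _)
    (fun _ _ _ => Subtype.ext <| funext fun _ => bracket_add_right _ _ _)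
    (fun _ _ _ => Subtype.ext <| funext fun _ => bracket_smul_right _ _ _)

theorem evolutionBracket_apply (ha : a ≠ 0) (h₁ : ε₁ * ε₁ = 1) (h₂ : ε₂ * ε₂ = 1)
    (V U : evolutionFields I q a ε₁ ε₂) (γ : Curve I q a ε₁ ε₂) :
    (evolutionBracket I q ha h₁ h₂ V U).1 γ = bracket a ε₁ ε₂ (V.1 γ) (U.1 γ) := rfl

theorem evolDer_apply (p r f : ScalarField I q a ε₁ ε₂) (γ : Curve I q a ε₁ ε₂) :
    evolDer p r f γ = evolPoly (p γ) (r γ) (f γ) := rfl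

theorem curvatureFlow_add (V U : VectorField I q a ε₁ ε₂) :
    curvatureFlow (V + U) = curvatureFlow V + curvatureFlow U := by
  simp only [curvatureFlow, Pi.add_apply, act_add, Derivation.add_apply]; rfl

theorem curvatureFlow_smul (c : ℝ) (V : VectorField I q a ε₁ ε₂) :
    curvatureFlow (c • V) = c • curvatureFlow V := by
  simp only [curvatureFlow, Pi.smul_apply, act_smul, Derivation.smul_apply]; rfl

/-- The map `V ↦ ∂_{(V(k₁), V(k₂))}`. -/
noncomputable def toEvolutionDerivations (I : Set ℝ) (q : ℕ) (a ε₁ ε₂ : ℝ) :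
    evolutionFields I q a ε₁ ε₂ →ₗ[ℝ] evolutionDerivations I q a ε₁ ε₂ where
  toFun V := ⟨evolDer (curvatureFlow V.1).1 (curvatureFlow V.1).2, _, _, rfl⟩
  map_add' V U := by
    refine Subtype.ext (Derivation.ext fun f => funext fun γ => ?_)
    have : (V + U).1 = V.1 + U.1 := rfl
    simp only [this, curvatureFlow_add]
    exact evolPoly_add _ _ _ _ _
  map_smul' c V := by
    refine Subtype.ext (Derivation.ext fun f => funext fun γ => ?_)
    have : (c • V).1 = c • V.1 := rfl
    simp only [this, curvatureFlow_smul]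
    exact evolPoly_smul _ _ _ _

/-- `V` acts on `𝒫` as the evolution derivation along its own flow, so the bracket of flows is the
commutator of the actions applied to `k₁` and `k₂`. -/
theorem flowBracket_curvatureFlow (ha : a ≠ 0) (h₁ : ε₁ * ε₁ = 1) (h₂ : ε₂ * ε₂ = 1)
    (V U : evolutionFields I q a ε₁ ε₂) :
    flowBracket (curvatureFlow V.1) (curvatureFlow U.1) =
      curvatureFlow (evolutionBracket I q ha h₁ h₂ V U).1 := by
  have hact : ∀ (V : evolutionFields I q a ε₁ ε₂) γ, act a ε₁ ε₂ (V.1 γ) =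
      evolPoly (act a ε₁ ε₂ (V.1 γ) κ₁) (act a ε₁ ε₂ (V.1 γ) κ₂) := fun V γ => by
    rw [act_κ₁, act_κ₂, act_eq_evolPoly ((V.2 γ).rho_eq_zero ha h₁)]
  refine Prod.ext (funext fun γ => ?_) (funext fun γ => ?_)
  · simp only [flowBracket, curvatureFlow, Pi.sub_apply, evolDer_apply, ← hact,
      evolutionBracket_apply, (act_bracket_and_covD_bracket ha h₁ h₂ (V.2 γ) (U.2 γ)).1,
      Derivation.commutator_apply]
  · simp only [flowBracket, curvatureFlow, Pi.sub_apply, evolDer_apply, ← hact,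
      evolutionBracket_apply, (act_bracket_and_covD_bracket ha h₁ h₂ (V.2 γ) (U.2 γ)).1,
      Derivation.commutator_apply]

theorem toEvolutionDerivations_bracket (ha : a ≠ 0) (h₁ : ε₁ * ε₁ = 1) (h₂ : ε₂ * ε₂ = 1)
    (V U : evolutionFields I q a ε₁ ε₂) :
    toEvolutionDerivations I q a ε₁ ε₂ (evolutionBracket I q ha h₁ h₂ V U) =
      ⁅toEvolutionDerivations I q a ε₁ ε₂ V, toEvolutionDerivations I q a ε₁ ε₂ U⁆ := by
  refine Subtype.ext ?_
  have := evolDer_commutator (curvatureFlow V.1) (curvatureFlow U.1)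
  rw [flowBracket_curvatureFlow ha h₁ h₂] at this
  exact this.symm

theorem eq_zero_of_curvatureFlow (ha : a ≠ 0) (h₁ : ε₁ * ε₁ = 1) (h₂ : ε₂ * ε₂ = 1)
    {V : evolutionFields I q a ε₁ ε₂} (h : curvatureFlow V.1 = 0) : V = 0 :=
  Subtype.ext <| funext fun γ => by
    have k₁ : (curvatureFlow V.1).1 γ = 0 := by rw [h]; rfl
    have k₂ : (curvatureFlow V.1).2 γ = 0 := by rw [h]; rfl
    rw [(V.2 γ).eq_zero_of_act (ε₂ := ε₂) ha h₁ h₂ k₁ k₂]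
    rfl

theorem toEvolutionDerivations_injective (ha : a ≠ 0) (h₁ : ε₁ * ε₁ = 1) (h₂ : ε₂ * ε₂ = 1) :
    Function.Injective (toEvolutionDerivations I q a ε₁ ε₂) := by
  refine (injective_iff_map_eq_zero _).2 fun V hV => eq_zero_of_curvatureFlow ha h₁ h₂ ?_
  have e : evolDer (curvatureFlow V.1).1 (curvatureFlow V.1).2 = 0 := congrArg Subtype.val hV
  -- Testing on constant scalar fields suffices: the values at `k₁` and `k₂` are the flow itself.
  have k : ∀ (p : DiffPoly) γ, evolPoly ((curvatureFlow V.1).1 γ) ((curvatureFlow V.1).2 γ) p = 0 :=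
    fun p γ => congrFun (DFunLike.congr_fun e fun _ => p) γ
  refine Prod.ext (funext fun γ => ?_) (funext fun γ => ?_)
  · simpa [evolPoly, κ₁, mkDerivation_X] using k κ₁ γ
  · simpa [evolPoly, κ₂, mkDerivation_X] using k κ₂ γ

end Global

/-! ### Calculus along the interval -/

section Calculus

variable {I : Set ℝ} {F : Type} [NormedAddCommGroup F] [NormedSpace ℝ F]

theorem ext_apply {F : Type} [Zero F] (X : I → F) (s : I) : ext X s = X s :=
  Subtype.val_injective.extend_apply _ _ _

theorem Smooth.congr {X : I → F} {Y : ℝ → F} (hY : ContDiffOn ℝ ∞ Y I) (h : ∀ s : I, X s = Y s) :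
    Smooth X :=
  ContDiffOn.congr hY fun s hs => (ext_apply X ⟨s, hs⟩).trans (h ⟨s, hs⟩)

/-- `derivWithin` sees only values on `I`, so the extension by zero may be replaced by any function
agreeing with it there. -/
theorem dσ_congr (hI : UniqueDiffOn ℝ I) {X X' : I → F} {Y : ℝ → F} (h : ∀ s : I, X s = Y s)
    (hY : ∀ s : I, HasDerivWithinAt Y (X' s) I s) : dσ X = X' :=
  funext fun s => ((hY s).congr (fun t ht => (ext_apply X ⟨t, ht⟩).trans (h ⟨t, ht⟩))
    ((ext_apply X s).trans (h s))).derivWithin (hI s s.2)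

theorem Smooth.hasDerivWithinAt {X : I → F} (hX : Smooth X) (s : I) :
    HasDerivWithinAt (ext X) (dσ X s) I s :=
  ((hX.differentiableOn (by simp)) s s.2).hasDerivWithinAt

theorem Smooth.dσ (hI : UniqueDiffOn ℝ I) {X : I → F} (hX : Smooth X) : Smooth (dσ X) :=
  Smooth.congr (hX.derivWithin hI (by simp)) fun _ => rfl

theorem smooth_restrict {X : ℝ → F} (hX : ContDiff ℝ ∞ X) : Smooth fun s : I => X s :=
  Smooth.congr hX.contDiffOn fun _ => rfl

theorem dσ_restrict (hI : UniqueDiffOn ℝ I) {X X' : ℝ → F} (h : ∀ s, HasDerivAt X (X' s) s) :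
    NullCurve.dσ (fun s : I => X s) = fun s : I => X' s :=
  dσ_congr hI (fun _ => rfl) fun s => (h s).hasDerivWithinAt

theorem Smooth.add {X Y : I → F} (hX : Smooth X) (hY : Smooth Y) : Smooth (X + Y) :=
  Smooth.congr (ContDiffOn.add hX hY) fun s => by simp [ext_apply]

theorem dσ_add (hI : UniqueDiffOn ℝ I) {X Y : I → F} (hX : Smooth X) (hY : Smooth Y) :
    NullCurve.dσ (X + Y) = NullCurve.dσ X + NullCurve.dσ Y :=
  dσ_congr hI (fun s => by simp [ext_apply])
    fun s => (hX.hasDerivWithinAt s).add (hY.hasDerivWithinAt s)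

theorem Smooth.smul {f : I → ℝ} {X : I → F} (hf : Smooth f) (hX : Smooth X) :
    Smooth fun s => f s • X s :=
  Smooth.congr (ContDiffOn.smul hf hX) fun s => by simp [ext_apply]

theorem dσ_smul (hI : UniqueDiffOn ℝ I) {f : I → ℝ} {X : I → F} (hf : Smooth f) (hX : Smooth X) :
    NullCurve.dσ (fun s => f s • X s) =
      fun s => f s • NullCurve.dσ X s + NullCurve.dσ f s • X s :=
  dσ_congr hI (Y := ext f • ext X) (fun s => by simp [ext_apply])
    fun s => by simpa [ext_apply] using (hf.hasDerivWithinAt s).smul (hX.hasDerivWithinAt s)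

end Calculus

/-! ### The polynomial model along an actual curve -/

section Realization

variable {I : Set ℝ} {q : ℕ} {a ε₁ ε₂ : ℝ}

theorem smooth_iterate_dσ (hI : UniqueDiffOn ℝ I) {k : I → ℝ} (hk : Smooth k) (m : ℕ) :
    Smooth (dσ^[m] k) := by
  induction m with
  | zero => exact hk
  | succ m ih => rw [Function.iterate_succ_apply']; exact ih.dσ hI

theorem evalAt_X (γ : Curve I q a ε₁ ε₂) (v : Fin 2 × ℕ) :
    evalAt γ (X v) = dσ^[v.2] (![γ.k₁, γ.k₂] v.1) := aeval_X _ _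

theorem evalAt_κ₁ (γ : Curve I q a ε₁ ε₂) : evalAt γ κ₁ = γ.k₁ := evalAt_X γ (0, 0)

theorem evalAt_κ₂ (γ : Curve I q a ε₁ ε₂) : evalAt γ κ₂ = γ.k₂ := evalAt_X γ (1, 0)

theorem smooth_evalAt_X (hI : UniqueDiffOn ℝ I) (γ : Curve I q a ε₁ ε₂) (v : Fin 2 × ℕ) :
    Smooth (evalAt γ (X v)) := by
  obtain ⟨i, m⟩ := v
  rw [evalAt_X]
  fin_cases i
  · exact smooth_iterate_dσ hI γ.smooth_k₁ m
  · exact smooth_iterate_dσ hI γ.smooth_k₂ m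

/-- Smoothness and the derivative go through one induction, since the product rule needs the factors
to be smooth. -/
theorem smooth_and_dσ_evalAt (hI : UniqueDiffOn ℝ I) (γ : Curve I q a ε₁ ε₂) (p : DiffPoly) :
    Smooth (evalAt γ p) ∧ dσ (evalAt γ p) = evalAt γ (D p) := by
  induction p using MvPolynomial.induction_on with
  | C c =>
    have hc : evalAt γ (C c) = fun _ => c := by
      rw [← algebraMap_eq, AlgHom.commutes]; rfl
    rw [hc, ← algebraMap_eq, Derivation.map_algebraMap, map_zero]
    exact ⟨smooth_restrict (X := fun _ => c) contDiff_const,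
      dσ_restrict hI (X := fun _ => c) (X' := fun _ => 0) fun s => hasDerivAt_const s c⟩
  | add p r hp hr =>
    rw [map_add, map_add, map_add, ← hp.2, ← hr.2]
    exact ⟨hp.1.add hr.1, dσ_add hI hp.1 hr.1⟩
  | mul_X p v hp =>
    have hv := smooth_evalAt_X hI γ v
    have e : evalAt γ (p * X v) = fun s => evalAt γ p s • evalAt γ (X v) s := by
      rw [map_mul]; rfl
    have hDv : dσ (evalAt γ (X v)) = evalAt γ (D (X v)) := by
      rw [D_X, evalAt_X, evalAt_X, Function.iterate_succ_apply']
    refine ⟨e ▸ hp.1.smul hv, ?_⟩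
    rw [e, dσ_smul hI hp.1 hv, hp.2, hDv]
    funext s
    simp only [Derivation.leibniz, smul_eq_mul, map_add, map_mul, Pi.add_apply, Pi.mul_apply]
    ring

theorem Curve.smooth_T (hI : UniqueDiffOn ℝ I) (γ : Curve I q a ε₁ ε₂) : Smooth γ.T :=
  γ.T_eq ▸ γ.smooth_curve.dσ hI

theorem dσ_realize (hI : UniqueDiffOn ℝ I) (γ : Curve I q a ε₁ ε₂) (V : LocalField) :
    dσ (realize γ V) = realize γ (nabla a ε₁ ε₂ V) := by
  have hs := fun p => (smooth_and_dσ_evalAt hI γ p).1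
  have hd := fun p => (smooth_and_dσ_evalAt hI γ p).2
  have e : realize γ V = (fun s => evalAt γ (V 0) s • γ.T s) + (fun s => evalAt γ (V 1) s • γ.W₁ s) +
    (fun s => evalAt γ (V 2) s • γ.N s) + fun s => evalAt γ (V 3) s • γ.W₂ s := rfl
  have h0 := (hs (V 0)).smul (γ.smooth_T hI)
  have h1 := (hs (V 1)).smul γ.smooth_W₁
  have h2 := (hs (V 2)).smul γ.smooth_N
  have h3 := (hs (V 3)).smul γ.smooth_W₂
  rw [e, dσ_add hI ((h0.add h1).add h2) h3, dσ_add hI (h0.add h1) h2, dσ_add hI h0 h1,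
    dσ_smul hI (hs _) (γ.smooth_T hI), dσ_smul hI (hs _) γ.smooth_W₁,
    dσ_smul hI (hs _) γ.smooth_N, dσ_smul hI (hs _) γ.smooth_W₂]
  funext s
  simp only [Pi.add_apply, γ.cartan_T, γ.cartan_W₁, γ.cartan_N, γ.cartan_W₂, hd, realize, nabla,
    Matrix.cons_val, map_add, map_sub, map_mul, map_smul, evalAt_κ₁, evalAt_κ₂, Pi.sub_apply,
    Pi.mul_apply, Pi.smul_apply, smul_eq_mul]
  module

theorem metric_add_left (x y z : Fin 4 → ℝ) : metric q (x + y) z = metric q x z + metric q y z := by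
  simp only [metric, ← Finset.sum_add_distrib, Pi.add_apply]
  exact Finset.sum_congr rfl fun _ _ => by ring

theorem metric_smul_left (c : ℝ) (x y : Fin 4 → ℝ) : metric q (c • x) y = c * metric q x y := by
  simp only [metric, Finset.mul_sum, Pi.smul_apply, smul_eq_mul]
  exact Finset.sum_congr rfl fun _ _ => by ring

theorem metric_comm (x y : Fin 4 → ℝ) : metric q x y = metric q y x := by
  simp only [metric, mul_comm (x _)]

theorem metric_realize_T (γ : Curve I q a ε₁ ε₂) (V : LocalField) (s : I) :
    metric q (realize γ V s) (γ.T s) = -evalAt γ (V 2) s := by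
  simp [realize, metric_add_left, metric_smul_left, γ.T_T, γ.W₁_T, metric_comm (γ.N s), γ.T_N,
    γ.W₂_T]

theorem metric_realize_W₁ (γ : Curve I q a ε₁ ε₂) (V : LocalField) (s : I) :
    metric q (realize γ V s) (γ.W₁ s) = evalAt γ (V 1) s * ε₁ := by
  simp [realize, metric_add_left, metric_smul_left, metric_comm (γ.T s), metric_comm (γ.N s),
    metric_comm (γ.W₂ s), γ.W₁_W₁, γ.W₁_T, γ.W₁_N, γ.W₁_W₂]

theorem metric_realize_W₂ (γ : Curve I q a ε₁ ε₂) (V : LocalField) (s : I) :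
    metric q (realize γ V s) (γ.W₂ s) = evalAt γ (V 3) s * ε₂ := by
  simp [realize, metric_add_left, metric_smul_left, γ.W₁_W₂, γ.W₂_W₂, metric_comm (γ.T s), γ.W₂_T,
    metric_comm (γ.N s), γ.W₂_N]

end Realization

/-! ### Linear differential equations -/

section LinearODE

open intervalIntegral

variable {E : Type*} [NormedAddCommGroup E] [NormedSpace ℝ E]

/-- The Volterra iterates of the initial value `x₀` for the equation `x' = A x`. -/
noncomputable def volterra (A : ℝ → E →L[ℝ] E) (t₀ : ℝ) (x₀ : E) : ℕ → ℝ → E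
  | 0 => fun _ => x₀
  | n + 1 => fun t => ∫ s in t₀..t, A s (volterra A t₀ x₀ n s)

/-- Continuity of one iterate gives the derivative of the next by the fundamental theorem of
calculus, and with it the continuity of the next. -/
theorem volterra_hasDerivAt [CompleteSpace E] {A : ℝ → E →L[ℝ] E} (hA : Continuous A) (t₀ : ℝ)
    (x₀ : E) (n : ℕ) :
    Continuous (volterra A t₀ x₀ n) ∧
      ∀ t, HasDerivAt (volterra A t₀ x₀ (n + 1)) (A t (volterra A t₀ x₀ n t)) t := by
  have key : ∀ n, Continuous (volterra A t₀ x₀ n) →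
      ∀ t, HasDerivAt (volterra A t₀ x₀ (n + 1)) (A t (volterra A t₀ x₀ n t)) t := fun n hn t =>
    ((hA.clm_apply hn).integral_hasStrictDerivAt t₀ t).hasDerivAt
  induction n with
  | zero => exact ⟨continuous_const, key 0 continuous_const⟩
  | succ n ih =>
    have : Continuous (volterra A t₀ x₀ (n + 1)) :=
      continuous_iff_continuousAt.2 fun t => (ih.2 t).continuousAt
    exact ⟨this, key _ this⟩

theorem norm_volterra_le [CompleteSpace E] {A : ℝ → E →L[ℝ] E} (t₀ : ℝ)
    (x₀ : E) {K R : ℝ} (hK : ∀ t, |t - t₀| ≤ R → ‖A t‖ ≤ K) (n : ℕ)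
    (t : ℝ) (ht : |t - t₀| ≤ R) :
    ‖volterra A t₀ x₀ n t‖ ≤ ‖x₀‖ * (K * |t - t₀|) ^ n / n.factorial := by
  have hK0 : 0 ≤ K := (norm_nonneg _).trans (hK t ht)
  induction n generalizing t with
  | zero => simp [volterra]
  | succ n ih =>
    rw [volterra, norm_intervalIntegral_eq]
    have hc : Continuous fun s => ‖x₀‖ * K ^ (n + 1) / n.factorial * |s - t₀| ^ n := by fun_prop
    calc _ ≤ ∫ s in Set.uIoc t₀ t, ‖x₀‖ * K ^ (n + 1) / n.factorial * |s - t₀| ^ n := by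
          refine MeasureTheory.norm_integral_le_of_norm_le
            (intervalIntegrable_iff.1 (hc.intervalIntegrable _ _)) ?_
          refine (MeasureTheory.ae_restrict_iff' measurableSet_uIoc).2 (Filter.Eventually.of_forall fun s hs => ?_)
          have hs' : |s - t₀| ≤ R :=
            (Set.abs_sub_left_of_mem_uIcc (Set.uIoc_subset_uIcc hs)).trans ht
          calc ‖A s (volterra A t₀ x₀ n s)‖ ≤ ‖A s‖ * ‖volterra A t₀ x₀ n s‖ := (A s).le_opNorm _
            _ ≤ K * (‖x₀‖ * (K * |s - t₀|) ^ n / n.factorial) :=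
              mul_le_mul (hK s hs') (ih s hs') (norm_nonneg _) hK0
            _ = _ := by rw [mul_pow]; ring
      _ = _ := by
          rw [MeasureTheory.integral_const_mul, integral_pow_abs_sub_uIoc, Nat.factorial_succ]
          push_cast
          have : (n.factorial : ℝ) ≠ 0 := by positivity
          have : (n : ℝ) + 1 ≠ 0 := by positivity
          field_simp
          ring

/-- The solution is the sum of the Volterra iterates. The factorial bound makes the series converge
on every bounded interval, so the solution is global without any continuation argument. -/
theorem exists_hasDerivAt_linear [CompleteSpace E] {A : ℝ → E →L[ℝ] E} (hA : Continuous A) (t₀ : ℝ)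
    (x₀ : E) :
    ∃ x : ℝ → E, x t₀ = x₀ ∧ ∀ t, HasDerivAt x (A t (x t)) t := by
  refine ⟨fun t => x₀ + ∑' n, volterra A t₀ x₀ (n + 1) t, ?_, fun t => ?_⟩
  · simp [volterra]
  -- The added `1` puts `t` inside an open ball on which the series may be differentiated term by
  -- term.
  set R := |t - t₀| + 1 with hR
  obtain ⟨K, hK⟩ := (isCompact_closedBall t₀ R).exists_bound_of_continuousOn hA.continuousOn
  have hK' : ∀ s, |s - t₀| ≤ R → ‖A s‖ ≤ K := fun s hs => hK s (by simpa [Real.dist_eq] using hs)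
  have hR0 : 0 < R := by positivity
  have hK0 : 0 ≤ K := (norm_nonneg _).trans (hK' t₀ (by simpa using hR0.le))
  have bound : ∀ n s, |s - t₀| ≤ R →
      ‖volterra A t₀ x₀ n s‖ ≤ ‖x₀‖ * ((K * R) ^ n / n.factorial) := fun n s hs => by
    refine (norm_volterra_le t₀ x₀ hK' n s hs).trans ?_
    rw [← mul_div_assoc]
    gcongr
  have hsum : Summable fun n : ℕ => ‖x₀‖ * ((K * R) ^ n / n.factorial) :=
    (Real.summable_pow_div_factorial _).mul_left _
  have hsumv : ∀ s, |s - t₀| ≤ R → Summable fun n => volterra A t₀ x₀ n s := fun s hs =>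
    Summable.of_norm_bounded hsum fun n => bound n s hs
  have hball : ∀ s ∈ Metric.ball t₀ R, |s - t₀| ≤ R := fun s hs => by
    rw [Metric.mem_ball, Real.dist_eq] at hs; exact hs.le
  have ht : t ∈ Metric.ball t₀ R := by rw [Metric.mem_ball, Real.dist_eq]; linarith
  have h := hasDerivAt_tsum_of_isPreconnected (hsum.mul_left K) Metric.isOpen_ball
    (convex_ball t₀ R).isPreconnected (g := fun n => volterra A t₀ x₀ (n + 1))
    (g' := fun n s => A s (volterra A t₀ x₀ n s))
    (fun n s _ => (volterra_hasDerivAt hA t₀ x₀ n).2 s)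
    (fun n s hs => ((A s).le_opNorm _).trans
      (mul_le_mul (hK' s (hball s hs)) (bound n s (hball s hs)) (norm_nonneg _) hK0))
    (Metric.mem_ball_self hR0)
    ((summable_nat_add_iff 1).2 (hsumv t₀ (by simpa using hR0.le))) ht
  have hs := hsumv t (hball t ht)
  have e : x₀ + ∑' n, volterra A t₀ x₀ (n + 1) t = ∑' n, volterra A t₀ x₀ n t := by
    rw [hs.tsum_eq_zero_add]; rfl
  beta_reduce
  rw [e, (A t).map_tsum hs]
  exact h.const_add x₀

theorem contDiff_of_linear {A : ℝ → E →L[ℝ] E} (hA : ContDiff ℝ ∞ A) {x : ℝ → E}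
    (hx : ∀ t, HasDerivAt x (A t (x t)) t) : ContDiff ℝ ∞ x := by
  refine contDiff_infty.2 fun n => ?_
  induction n with
  | zero =>
    exact contDiff_zero.2 (continuous_iff_continuousAt.2 fun t => (hx t).continuousAt)
  | succ n ih =>
    rw [Nat.cast_succ, contDiff_succ_iff_deriv]
    refine ⟨fun t => (hx t).differentiableAt, by simp, ?_⟩
    rw [show deriv x = fun t => A t (x t) from funext fun t => (hx t).deriv]
    exact (contDiff_infty.1 hA n).clm_apply ih

end LinearODE

end NullCurve

namespace NullCurve

/-! ### Existence of null curves with prescribed curvatures -/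

section Frames

variable {n : Type*}

theorem exists_matrix_linear [Fintype n] {M : ℝ → Matrix n n ℝ} (hM : ∀ i j, ContDiff ℝ ∞ fun t => M t i j)
    (t₀ : ℝ) (X₀ : Matrix n n ℝ) :
    ∃ X : ℝ → Matrix n n ℝ, X t₀ = X₀ ∧ (∀ i j, ContDiff ℝ ∞ fun t => X t i j) ∧
      ∀ t i j, HasDerivAt (fun t => X t i j) ((M t * X t) i j) t := by
  set A : ℝ → (n → ℝ) →L[ℝ] (n → ℝ) := fun t => LinearMap.toContinuousLinearMap (M t).mulVecLin
  have hA : ContDiff ℝ ∞ A := contDiff_clm_apply_iff.2 fun y => contDiff_pi.2 fun i => by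
    change ContDiff ℝ ∞ fun t => ∑ j, M t i j * y j
    exact ContDiff.sum fun j _ => (hM i j).mul contDiff_const
  choose x hx₀ hx using fun j => exists_hasDerivAt_linear hA.continuous t₀ fun i => X₀ i j
  refine ⟨fun t => Matrix.of fun i j => x j t i, ?_, fun i j => ?_, fun t i j => ?_⟩
  · ext i j
    exact congrFun (hx₀ j) i
  · exact contDiff_pi.1 (contDiff_of_linear hA (hx j)) i
  · exact hasDerivAt_pi.1 (hx j t) i

theorem hasDerivAt_matrix_mul [Fintype n] {X Y : ℝ → Matrix n n ℝ} {X' Y' : Matrix n n ℝ} {t : ℝ}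
    (hX : ∀ i j, HasDerivAt (fun t => X t i j) (X' i j) t)
    (hY : ∀ i j, HasDerivAt (fun t => Y t i j) (Y' i j) t) (i j : n) :
    HasDerivAt (fun t => (X t * Y t) i j) ((X' * Y t + X t * Y') i j) t := by
  simp only [Matrix.add_apply, Matrix.mul_apply, ← Finset.sum_add_distrib]
  exact HasDerivAt.fun_sum fun k _ => (hX i k).mul (hY k j)

theorem eq_of_matrix_hasDerivAt_zero {X : ℝ → Matrix n n ℝ}
    (hX : ∀ t i j, HasDerivAt (fun t => X t i j) 0 t) (s t : ℝ) : X s = X t := by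
  ext i j
  exact is_const_of_deriv_eq_zero (f := fun t => X t i j) (fun t => (hX t i j).differentiableAt)
    (fun t => (hX t i j).deriv) s t

/-- A linear system with values in the Lie algebra of the isometries of `J` has solutions with
prescribed Gram matrix `J` and positive orientation. -/
theorem exists_frame [Fintype n] [DecidableEq n] {M : ℝ → Matrix n n ℝ} (hM : ∀ i j, ContDiff ℝ ∞ fun t => M t i j)
    {J η F₀ : Matrix n n ℝ} (hJ : ∀ t, M t * J + J * (M t).transpose = 0)
    (h₀ : F₀ * η * F₀.transpose = J) (hdet : 0 < F₀.det) :
    ∃ F : ℝ → Matrix n n ℝ, (∀ i j, ContDiff ℝ ∞ fun t => F t i j) ∧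
      (∀ t i j, HasDerivAt (fun t => F t i j) ((M t * F t) i j) t) ∧
      (∀ t, F t * η * (F t).transpose = J) ∧ ∀ t, 0 < (F t).det := by
  have hu : IsUnit F₀.det := hdet.ne'.isUnit
  obtain ⟨F, hF₀, hF, hF'⟩ := exists_matrix_linear hM 0 F₀
  -- `H` solves the adjoint system, so `Hᵀ F` is constant and `Hᵀ` is the inverse of `F`. Then `Hᵀ J
  -- H` is constant as well, which gives the Gram matrix of `F` without appeal to uniqueness for the
  -- differential equation.
  obtain ⟨H, hH₀, -, hH'⟩ := exists_matrix_linear (M := fun t => -(M t).transpose)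
    (fun i j => (hM j i).neg) 0 (F₀⁻¹).transpose
  have hG : ∀ t i j, HasDerivAt (fun t => (H t).transpose i j) ((-((H t).transpose * M t)) i j) t := by
    intro t i j
    have := hH' t j i
    rwa [← Matrix.transpose_apply (-(M t).transpose * H t), Matrix.transpose_mul,
      Matrix.transpose_neg, Matrix.transpose_transpose, Matrix.mul_neg] at this
  have hGF : ∀ t, (H t).transpose * F t = 1 := fun t => by
    rw [eq_of_matrix_hasDerivAt_zero (X := fun t => (H t).transpose * F t) (fun t i j => by
      have := hasDerivAt_matrix_mul (hG t) (hF' t) i j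
      rwa [Matrix.neg_mul, Matrix.mul_assoc, neg_add_cancel] at this) t 0, hH₀, hF₀,
      Matrix.transpose_transpose, Matrix.nonsing_inv_mul _ hu]
  have hFG : ∀ t, F t * (H t).transpose = 1 := fun t => mul_eq_one_comm.1 (hGF t)
  have hGJ : ∀ t, (H t).transpose * J * H t = η := fun t => by
    rw [eq_of_matrix_hasDerivAt_zero (X := fun t => (H t).transpose * J * H t) (fun t i j => by
      have hc : ∀ i j, HasDerivAt (fun _ : ℝ => J i j) ((0 : Matrix n n ℝ) i j) t :=
        fun i j => hasDerivAt_const t _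
      have := hasDerivAt_matrix_mul (hasDerivAt_matrix_mul (hG t) hc) (hH' t) i j
      have e : (-((H t).transpose * M t) * J + (H t).transpose * 0) * H t +
          (H t).transpose * J * (-(M t).transpose * H t) =
          -((H t).transpose * (M t * J + J * (M t).transpose) * H t) := by
        noncomm_ring
      rw [e, hJ, Matrix.mul_zero, Matrix.zero_mul, neg_zero] at this
      exact this) t 0, hH₀, Matrix.transpose_transpose, ← h₀]
    calc F₀⁻¹ * (F₀ * η * F₀.transpose) * F₀⁻¹.transpose
        = F₀⁻¹ * F₀ * η * (F₀⁻¹ * F₀).transpose := by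
          rw [Matrix.transpose_mul]; simp only [Matrix.mul_assoc]
      _ = η := by rw [Matrix.nonsing_inv_mul _ hu]; simp
  refine ⟨F, hF, hF', fun t => ?_, fun t => ?_⟩
  · calc F t * η * (F t).transpose
        = F t * (H t).transpose * J * (F t * (H t).transpose).transpose := by
          rw [Matrix.transpose_mul, Matrix.transpose_transpose, ← hGJ t]
          simp only [Matrix.mul_assoc]
      _ = J := by rw [hFG]; simp
  -- `F` is invertible at all times, so its determinant cannot change sign.
  · have hne : ∀ t, (F t).det ≠ 0 := fun t h => by
      have := congrArg Matrix.det (hFG t)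
      rw [Matrix.det_mul, h, zero_mul, Matrix.det_one] at this
      exact zero_ne_one this
    have hc : Continuous fun t => (F t).det :=
      Continuous.matrix_det (continuous_matrix fun i j => (hF i j).continuous)
    by_contra! hlt
    obtain ⟨s, hs⟩ := mem_range_of_exists_le_of_exists_ge hc ⟨t, hlt⟩ ⟨0, (hF₀ ▸ hdet).le⟩
    exact hne s hs

end Frames

section Existence

variable {I : Set ℝ} {q : ℕ} {a ε₁ ε₂ : ℝ}

/-- The coefficients of the Cartan equations. -/
def cartanMatrix (a ε₁ ε₂ k₁ k₂ : ℝ) : Matrix (Fin 4) (Fin 4) ℝ :=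
  !![0, a, 0, 0; -k₁, 0, a * ε₁, 0; 0, -(ε₁ * k₁), 0, ε₂ * k₂; k₂, 0, 0, 0]

/-- The Gram matrix of a Cartan frame. -/
def cartanGram (ε₁ ε₂ : ℝ) : Matrix (Fin 4) (Fin 4) ℝ :=
  !![0, 0, -1, 0; 0, ε₁, 0, 0; -1, 0, 0, 0; 0, 0, 0, ε₂]

/-- This is the infinitesimal form of the conservation of the Gram matrix by the Cartan equations.
-/
theorem cartanMatrix_skew (h₁ : ε₁ * ε₁ = 1) (h₂ : ε₂ * ε₂ = 1) (k₁ k₂ : ℝ) :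
    cartanMatrix a ε₁ ε₂ k₁ k₂ * cartanGram ε₁ ε₂ +
      cartanGram ε₁ ε₂ * (cartanMatrix a ε₁ ε₂ k₁ k₂).transpose = 0 := by
  ext i j
  simp only [Matrix.add_apply, Matrix.mul_apply, Fin.sum_univ_four, Matrix.transpose_apply,
    cartanMatrix, cartanGram, Matrix.of_apply, Matrix.zero_apply]
  fin_cases i <;> fin_cases j <;> simp <;> grind

/-- The matrix of the scalar product. -/
def metricMatrix (q : ℕ) : Matrix (Fin 4) (Fin 4) ℝ :=
  Matrix.diagonal fun i => if (i : ℕ) < q then -1 else 1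

theorem metric_eq_gram (F : Matrix (Fin 4) (Fin 4) ℝ) (i j : Fin 4) :
    metric q (F i) (F j) = (F * metricMatrix q * F.transpose) i j := by
  rw [Matrix.mul_apply]
  simp only [metric, metricMatrix, Matrix.mul_diagonal, Matrix.transpose_apply]
  exact Finset.sum_congr rfl fun _ _ => by ring

theorem metric_one (x y : Fin 4 → ℝ) :
    metric 1 x y = -(x 0 * y 0) + x 1 * y 1 + x 2 * y 2 + x 3 * y 3 := by
  simp [metric, Fin.sum_univ_four]

theorem metric_two (x y : Fin 4 → ℝ) :
    metric 2 x y = -(x 0 * y 0) - x 1 * y 1 + x 2 * y 2 + x 3 * y 3 := by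
  simp [metric, Fin.sum_univ_four, sub_eq_add_neg]

theorem exists_cartan_basis
    (hq : (q = 1 ∧ ε₁ = 1 ∧ ε₂ = 1) ∨ (q = 2 ∧ ((ε₁ = 1 ∧ ε₂ = -1) ∨ (ε₁ = -1 ∧ ε₂ = 1)))) :
    ∃ F : Matrix (Fin 4) (Fin 4) ℝ,
      F * metricMatrix q * F.transpose = cartanGram ε₁ ε₂ ∧ 0 < F.det := by
  rcases hq with ⟨rfl, rfl, rfl⟩ | ⟨rfl, ⟨rfl, rfl⟩ | ⟨rfl, rfl⟩⟩
  -- The rows are `T, W₁, N, W₂`. `T` and `N` are the null vectors `e + e'` and `±(e - e')/2` in a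
  -- Lorentzian coordinate plane; the remaining axes are ordered, and in the last case one is
  -- reversed, to make the determinant positive.
  · refine ⟨!![1, 1, 0, 0; 0, 0, 1, 0; 1 / 2, -1 / 2, 0, 0; 0, 0, 0, 1], ?_, ?_⟩
    · ext i j
      rw [← metric_eq_gram, metric_one]
      fin_cases i <;> fin_cases j <;> simp [cartanGram] <;> norm_num
    · simp [Matrix.det_succ_row_zero, Fin.sum_univ_succ, Fin.succAbove]
      norm_num
  · refine ⟨!![1, 0, 1, 0; 0, 0, 0, 1; 1 / 2, 0, -1 / 2, 0; 0, 1, 0, 0], ?_, ?_⟩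
    · ext i j
      rw [← metric_eq_gram, metric_two]
      fin_cases i <;> fin_cases j <;> simp [cartanGram] <;> norm_num
    · simp [Matrix.det_succ_row_zero, Fin.sum_univ_succ, Fin.succAbove]
      norm_num
  · refine ⟨!![1, 0, 1, 0; 0, 1, 0, 0; 1 / 2, 0, -1 / 2, 0; 0, 0, 0, -1], ?_, ?_⟩
    · ext i j
      rw [← metric_eq_gram, metric_two]
      fin_cases i <;> fin_cases j <;> simp [cartanGram] <;> norm_num
    · simp [Matrix.det_succ_row_zero, Fin.sum_univ_succ, Fin.succAbove]
      norm_num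

/-- The Cartan system is solved on the whole line from a suitable frame, `T` is integrated to give
the curve, and everything is restricted to `I`. -/
theorem exists_curve (hI : UniqueDiffOn ℝ I) (h₁ : ε₁ * ε₁ = 1) (h₂ : ε₂ * ε₂ = 1)
    (hq : (q = 1 ∧ ε₁ = 1 ∧ ε₂ = 1) ∨ (q = 2 ∧ ((ε₁ = 1 ∧ ε₂ = -1) ∨ (ε₁ = -1 ∧ ε₂ = 1))))
    {k₁ k₂ : ℝ → ℝ} (hk₁ : ContDiff ℝ ∞ k₁) (hk₂ : ContDiff ℝ ∞ k₂) :
    ∃ γ : Curve I q a ε₁ ε₂, γ.k₁ = (fun s : I => k₁ s) ∧ γ.k₂ = fun s : I => k₂ s := by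
  obtain ⟨F₀, hF₀, hdet⟩ := exists_cartan_basis hq
  obtain ⟨F, hF, hF', hg, hd⟩ := exists_frame (M := fun t => cartanMatrix a ε₁ ε₂ (k₁ t) (k₂ t))
    (fun i j => by fin_cases i <;> fin_cases j <;> simp [cartanMatrix] <;> fun_prop)
    (fun t => cartanMatrix_skew h₁ h₂ _ _) hF₀ hdet
  have hrow : ∀ i, ContDiff ℝ ∞ fun t => F t i := fun i => contDiff_pi.2 (hF i)
  have hrow' : ∀ i t, HasDerivAt (fun t => F t i)
      ((cartanMatrix a ε₁ ε₂ (k₁ t) (k₂ t) * F t) i) t :=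
    fun i t => hasDerivAt_pi.2 (hF' t i)
  have hm : ∀ i j t, metric q (F t i) (F t j) = cartanGram ε₁ ε₂ i j := fun i j t => by
    rw [metric_eq_gram, hg]
  have hcurve : ∀ t, HasDerivAt (fun t => ∫ s in (0 : ℝ)..t, F s 0) (F t 0) t := fun t =>
    ((hrow 0).continuous.integral_hasStrictDerivAt 0 t).hasDerivAt
  refine ⟨{
    curve := fun s => ∫ u in (0 : ℝ)..s, F u 0
    T := fun s => F s 0
    W₁ := fun s => F s 1
    N := fun s => F s 2
    W₂ := fun s => F s 3
    k₁ := fun s => k₁ s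
    k₂ := fun s => k₂ s
    smooth_curve := smooth_restrict (X := fun t => ∫ s in (0 : ℝ)..t, F s 0)
      (contDiff_infty_iff_deriv.2 ⟨fun t => (hcurve t).differentiableAt, by
        rw [show deriv (fun t => ∫ s in (0 : ℝ)..t, F s 0) = fun t => F t 0 from
          funext fun t => (hcurve t).deriv]
        exact hrow 0⟩)
    smooth_W₁ := smooth_restrict (hrow 1)
    smooth_N := smooth_restrict (hrow 2)
    smooth_W₂ := smooth_restrict (hrow 3)
    smooth_k₁ := smooth_restrict hk₁
    smooth_k₂ := smooth_restrict hk₂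
    T_eq := (dσ_restrict hI hcurve).symm
    T_T := fun s => hm 0 0 s
    N_N := fun s => hm 2 2 s
    T_N := fun s => hm 0 2 s
    W₁_T := fun s => hm 1 0 s
    W₁_N := fun s => hm 1 2 s
    W₂_T := fun s => hm 3 0 s
    W₂_N := fun s => hm 3 2 s
    W₁_W₁ := fun s => hm 1 1 s
    W₂_W₂ := fun s => hm 3 3 s
    W₁_W₂ := fun s => hm 1 3 s
    oriented := fun s => by
      have e : Matrix.of ![F s 0, F s 1, F s 2, F s 3] = F s := by
        ext i j; fin_cases i <;> rfl
      rw [e]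
      exact hd s
    cartan_T := fun s => ?_
    cartan_W₁ := fun s => ?_
    cartan_N := fun s => ?_
    cartan_W₂ := fun s => ?_ }, rfl, rfl⟩
  · rw [dσ_restrict hI (hrow' 0)]
    ext j
    simp [Matrix.mul_apply, Fin.sum_univ_four, cartanMatrix]
  · rw [dσ_restrict hI (hrow' 1)]
    ext j
    simp [Matrix.mul_apply, Fin.sum_univ_four, cartanMatrix]
  · rw [dσ_restrict hI (hrow' 2)]
    ext j
    simp [Matrix.mul_apply, Fin.sum_univ_four, cartanMatrix]
  · rw [dσ_restrict hI (hrow' 3)]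
    ext j
    simp [Matrix.mul_apply, Fin.sum_univ_four, cartanMatrix]

/-! ### Prescribed jets and faithfulness -/

open Polynomial in
theorem exists_polynomial_jet (c : ℕ → ℝ) (N : ℕ) (t : ℝ) :
    ∃ P : ℝ[X], ∀ m < N, (derivative^[m] P).eval t = c m := by
  -- Taylor's formula: `taylor (-t)` substitutes `X - t`, which centres the polynomial at `t`.
  refine ⟨taylor (-t) (∑ m ∈ Finset.range N, monomial m (c m / m.factorial)), fun m hm => ?_⟩
  rw [← factorial_smul_hasseDeriv, LinearMap.smul_apply, eval_smul, ← taylor_coeff, taylor_taylor]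
  have : (m.factorial : ℝ) ≠ 0 := by positivity
  simp [coeff_monomial, hm]
  field_simp

theorem iterate_dσ_polynomial (hI : UniqueDiffOn ℝ I) (P : Polynomial ℝ) (m : ℕ) :
    dσ^[m] (fun s : I => P.eval (s : ℝ)) = fun s : I => (Polynomial.derivative^[m] P).eval (s : ℝ) := by
  induction m with
  | zero => rfl
  | succ m ih =>
    rw [Function.iterate_succ_apply', ih, Function.iterate_succ_apply']
    exact dσ_restrict hI fun s => Polynomial.hasDerivAt _ s

/-- A differential polynomial that vanishes along every curve is zero. -/
theorem eq_zero_of_evalAt_eq_zero (hI : UniqueDiffOn ℝ I) (hI' : I.Nonempty)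
    (h₁ : ε₁ * ε₁ = 1) (h₂ : ε₂ * ε₂ = 1)
    (hq : (q = 1 ∧ ε₁ = 1 ∧ ε₂ = 1) ∨ (q = 2 ∧ ((ε₁ = 1 ∧ ε₂ = -1) ∨ (ε₁ = -1 ∧ ε₂ = 1))))
    {p : DiffPoly} (hp : ∀ γ : Curve I q a ε₁ ε₂, evalAt γ p = 0) : p = 0 := by
  -- Over the infinite field `ℝ` it suffices that `p` vanishes at every point `c`. The coordinates
  -- of `c` that occur in `p` have bounded order, so they form the jet at `t` of the curvatures of
  -- some curve.
  refine MvPolynomial.funext fun c => ?_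
  obtain ⟨t, ht⟩ := hI'
  obtain ⟨P₁, hP₁⟩ := exists_polynomial_jet (fun m => c (0, m)) (p.vars.sup Prod.snd + 1) t
  obtain ⟨P₂, hP₂⟩ := exists_polynomial_jet (fun m => c (1, m)) (p.vars.sup Prod.snd + 1) t
  obtain ⟨γ, hγ₁, hγ₂⟩ := exists_curve (a := a) hI h₁ h₂ hq (k₁ := fun t => P₁.eval t)
    (k₂ := fun t => P₂.eval t) (by simpa using P₁.contDiff_aeval (𝕜 := ℝ) ∞)
    (by simpa using P₂.contDiff_aeval (𝕜 := ℝ) ∞)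
  rw [map_zero]
  refine Eq.trans ?_ (congrFun (hp γ) ⟨t, ht⟩)
  change MvPolynomial.eval c p =
    ((Pi.evalRingHom (fun _ : I => ℝ) ⟨t, ht⟩).comp (evalAt γ : DiffPoly →+* (I → ℝ))) p
  refine MvPolynomial.hom_congr_vars ?_ ?_ rfl
  · ext r
    simp
  · rintro ⟨i, m⟩ hv -
    have hm : m < p.vars.sup Prod.snd + 1 :=
      Nat.lt_succ_of_le (Finset.le_sup (f := Prod.snd) hv)
    have e : ∀ v, ((Pi.evalRingHom (fun _ : I => ℝ) ⟨t, ht⟩).comp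
        (evalAt γ : DiffPoly →+* (I → ℝ))) (MvPolynomial.X v) =
        dσ^[v.2] (![γ.k₁, γ.k₂] v.1) ⟨t, ht⟩ := fun v => congrFun (evalAt_X γ v) _
    rw [e, MvPolynomial.eval_X, hγ₁, hγ₂]
    fin_cases i
    · exact (hP₁ m hm).symm.trans (congrFun (iterate_dσ_polynomial hI P₁ m) ⟨t, ht⟩).symm
    · exact (hP₂ m hm).symm.trans (congrFun (iterate_dσ_polynomial hI P₂ m) ⟨t, ht⟩).symm

end Existence

end NullCurve

/-! ### The main theorem -/

open NullCurve
theorem theorem1 (I : Set ℝ) (hI : I.OrdConnected) (hI' : (interior I).Nonempty)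
    (q : ℕ) (a ε₁ ε₂ : ℝ) (ha : 0 < a)
    (hq : (q = 1 ∧ ε₁ = 1 ∧ ε₂ = 1) ∨ (q = 2 ∧ ((ε₁ = 1 ∧ ε₂ = -1) ∨ (ε₁ = -1 ∧ ε₂ = 1)))) :
    -- a differential polynomial is determined by the scalar field on `Λ` that it induces
    (∀ p : DiffPoly, (∀ γ : Curve I q a ε₁ ε₂, evalAt γ p = 0) → p = 0) ∧
    -- the evolution vector fields are tangent to `Λ`, and `φ_V`, `ψ_V` are the components of `∇_T V`
    (∀ V ∈ evolutionFields I q a ε₁ ε₂, ∀ (γ : Curve I q a ε₁ ε₂) (s : I),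
      metric q (dσ (realize γ (V γ)) s) (γ.T s) = 0 ∧
      metric q (dσ (dσ (realize γ (V γ))) s) (γ.W₁ s) = 0 ∧
      ε₁ * metric q (dσ (realize γ (V γ)) s) (γ.W₁ s) = evalAt γ (phi a ε₁ ε₂ (V γ)) s ∧
      ε₂ * metric q (dσ (realize γ (V γ)) s) (γ.W₂ s) = evalAt γ (psi a ε₁ ε₂ (V γ)) s) ∧
    -- the bracket makes `𝔛_𝒜(Λ)` a Lie algebra
    ∃ B : evolutionFields I q a ε₁ ε₂ →ₗ[ℝ] evolutionFields I q a ε₁ ε₂ →ₗ[ℝ]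
        evolutionFields I q a ε₁ ε₂,
      (∀ V U γ, (B V U).1 γ = bracket a ε₁ ε₂ (V.1 γ) (U.1 γ)) ∧
      (∀ V, B V V = 0) ∧
      (∀ V U W, B V (B U W) + B U (B W V) + B W (B V U) = 0) ∧
      -- `Φ` is an injective homomorphism of Lie algebras
      ∃ Φ : evolutionFields I q a ε₁ ε₂ →ₗ[ℝ] evolutionDerivations I q a ε₁ ε₂,
        (∀ V, (Φ V).1 = evolDer (curvatureFlow V.1).1 (curvatureFlow V.1).2) ∧
        (∀ V, (Φ V).1 = evolDer
          (fun γ => Theta₁ a (phi a ε₁ ε₂ (V.1 γ)) (-psi a ε₁ ε₂ (V.1 γ)))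
          (fun γ => Theta₂ a ε₁ ε₂ (phi a ε₁ ε₂ (V.1 γ)) (-psi a ε₁ ε₂ (V.1 γ)))) ∧
        (∀ V U, Φ (B V U) = ⁅Φ V, Φ U⁆) ∧
        Function.Injective Φ ∧
        -- two evolution fields commute if and only if their curvature flows commute
        (∀ V U, B V U = 0 ↔ flowBracket (curvatureFlow V.1) (curvatureFlow U.1) = 0) := by
  have ha' : a ≠ 0 := ha.ne'
  have h₁ : ε₁ * ε₁ = 1 := by
    rcases hq with ⟨-, rfl, -⟩ | ⟨-, ⟨rfl, -⟩ | ⟨rfl, -⟩⟩ <;> norm_num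
  have h₂ : ε₂ * ε₂ = 1 := by
    rcases hq with ⟨-, -, rfl⟩ | ⟨-, ⟨-, rfl⟩ | ⟨-, rfl⟩⟩ <;> norm_num
  -- An interval with nonempty interior has unique one-sided derivatives, also at its end points.
  have hU : UniqueDiffOn ℝ I := uniqueDiffOn_convex hI.convex hI'
  refine ⟨fun p hp => eq_zero_of_evalAt_eq_zero hU (hI'.mono interior_subset) h₁ h₂ hq hp,
    fun V hV γ s => ?_, evolutionBracket I q ha' h₁ h₂, fun _ _ _ => rfl,
    fun V => Subtype.ext <| funext fun _ => bracket_self _,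
    fun V U W => Subtype.ext <| funext fun γ => bracket_jacobi ha' h₁ h₂ (V.2 γ) (U.2 γ) (W.2 γ),
    toEvolutionDerivations I q a ε₁ ε₂, fun _ => rfl, fun V => ?_,
    toEvolutionDerivations_bracket ha' h₁ h₂, toEvolutionDerivations_injective ha' h₁ h₂,
    fun V U => ?_⟩
  · obtain ⟨hg, hw⟩ := (isEvolution_iff (ε₂ := ε₂) ha' h₁ _).1 (hV γ)
    rw [dσ_realize hU, dσ_realize hU, metric_realize_T, metric_realize_W₁, metric_realize_W₁,
      metric_realize_W₂, hg, hw, phi_eq h₁, psi_eq h₂, mul_left_comm, h₁, mul_one, mul_left_comm,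
      h₂, mul_one, map_zero]
    simp
  · have hρ := fun γ => (V.2 γ).rho_eq_zero (ε₂ := ε₂) ha' h₁
    have e : curvatureFlow V.1 =
        (fun γ => Theta₁ a (phi a ε₁ ε₂ (V.1 γ)) (-psi a ε₁ ε₂ (V.1 γ)),
          fun γ => Theta₂ a ε₁ ε₂ (phi a ε₁ ε₂ (V.1 γ)) (-psi a ε₁ ε₂ (V.1 γ))) := by
      simp only [curvatureFlow, act_κ₁, act_κ₂, actK₁_eq_Theta₁ (hρ _), actK₂_eq_Theta₂ (hρ _)]
    change evolDer (curvatureFlow V.1).1 (curvatureFlow V.1).2 = _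
    rw [e]
  -- The bracket of the flows is the flow of the bracket, and a flow vanishes only for the zero
  -- field.
  · rw [flowBracket_curvatureFlow ha' h₁ h₂]
    refine ⟨fun h => ?_, eq_zero_of_curvatureFlow ha' h₁ h₂⟩
    rw [h]
    simpa using curvatureFlow_smul (0 : ℝ) (0 : VectorField I q a ε₁ ε₂)
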